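/- Let $Z_i=(W_i,X_i,Y_i)$, $i\ge 1$, be i.i.d. with law $P_0$ on $\mathbb{R}^{d_2}\times\mathbb{R}^{d_1}\times\mathbb{R}$, with $E_0[Y^2]<\infty$. Let $\mathcal{F}$ be a class of measurable functions $f(w,x)$ with $E_0[f(W,X)^2]<\infty$, and let $\mathcal{B}\subset\mathbb{R}$ be a bounded symmetric interval. Put $\mu_{P_0,Y}(w)=E_0[Y\mid W=w]$, $\mu_{P_0,f}(w)=E_0[f(W,X)\mid W=w]$, $$G_{0,f}(\beta)=\int\{y-\mu_{P_0,Y}(w)-\beta f(w,x)\}^2\,dP_0,$$ $$\phi_{0,f}(z;\beta)=\{y-\mu_{P_0,Y}(w)-\beta f(w,x)\}^2+2\beta\{y-\mu_{P_0,Y}(w)\}\mu_{P_0,f}(w)-G_{0,f}(\beta).$$ Let $\mu_{n,Y}$ and $\mu_{n,f}$ ($f\in\mathcal{F}$) be random measurable functions of $w$ (estimators of $\mu_{P_0,Y}$ and $\mu_{P_0,f}$), and put $$G_{n,f}(\beta)=\frac1n\sum_{i=1}^n\{Y_i-\mu_{n,Y}(W_i)-\beta f(W_i,X_i)\}^2,$$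 $$\phi_{n,f}(z;\beta)=\{y-\mu_{n,Y}(w)-\beta f(w,x)\}^2+2\beta\{y-\mu_{n,Y}(w)\}\mu_{n,f}(w)-G_{n,f}(\beta),$$ $$\tilde G_{n,f}(\beta)=G_{n,f}(\beta)+\frac1n\sum_{i=1}^n\phi_{n,f}(Z_i;\beta).$$ Primes denote derivatives in $\beta$, and $o_P$ is understood in outer probability. Suppose that $$\Big[\int\{\mu_{P_0,Y}-\mu_{n,Y}\}^2dP_0\Big]^{1/2}=o_P(n^{-1/4}),\qquad \sup_{f\in\mathcal{F}}\Big|\int\{\mu_{P_0,f}-\mu_{n,f}\}\{\mu_{P_0,Y}-\mu_{n,Y}\}\,dP_0\Big|=o_P(n^{-1/2}),$$ and that the estimators $\mu_{n,f}$ are uniformly consistent: $\sup_{f\in\mathcal{F}}\int\{\mu_{P_0,f}-\mu_{n,f}\}^2dP_0=o_P(1)$. Suppose also that there are $P_0$-Donsker classes $\Phi,\Phi'$ and a $P_0$-Glivenko–Cantelli class $\Phi''$ such that, with probability tending to one, each of the following holds: $\{\phi_{n,f}(\cdot;\beta)-\phi_{0,f}(\cdot;\beta): f\in\mathcal{F},\beta\in\mathcal{B}\}\subset\Phi$,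 $\{\phi'_{n,f}(\cdot;0)-\phi'_{0,f}(\cdot;0): f\in\mathcal{F}\}\subset\Phi'$, and $\{\phi''_{n,f}(\cdot;0)-\phi''_{0,f}(\cdot;0): f\in\mathcal{F}\}\subset\Phi''$. Let $\tilde r_{n,f}(\beta)=\{\tilde G_{n,f}(\beta)-G_{0,f}(\beta)\}-\frac1n\sum_{i=1}^n\phi_{0,f}(Z_i;\beta)$. Then: 1. $\tilde G_{n,f_1}(0)=\tilde G_{n,f_2}(0)$ for all $f_1\ne f_2$ in $\mathcal{F}$; 2. $\sup_{f\in\mathcal{F},\beta\in\mathcal{B}}|\tilde r_{n,f}(\beta)|=o_P(n^{-1/2})$; 3. $\tilde G_{n,f}$ and $\tilde r_{n,f}$ are differentiable in $\beta$, and $\sup_{f\in\mathcal{F},\beta\in\mathcal{B}}|\tilde r'_{n,f}(\beta)|=o_P(n^{-1/2})$; 4. $\tilde G_{n,f}$ and $\tilde r_{n,f}$ are twice differentiable in $\beta$, and $\sup_{f\in\mathcal{F},\beta\in\mathcal{B}}|\tilde r''_{n,f}(\beta)|=o_P(1)$. -/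

import Mathlib

open MeasureTheory ProbabilityTheory Filter Topology
open scoped ENNReal BoundedContinuousFunction

noncomputable section

namespace ImprovementInFit

/-! ### Empirical means and stochastic orders -/

/-- The empirical mean `(1/n) ∑ᵢ g(zᵢ)` of `g` over a sample of size `n`. -/
def empMean {S : Type*} {n : ℕ} (z : Fin n → S) (g : S → ℝ) : ℝ :=
  (n : ℝ)⁻¹ * ∑ i, g (z i)

/-- The first `n` observations, at the sample point `ω`. -/
def sample {Ω S : Type*} (Z : ℕ → Ω → S) (n : ℕ) (ω : Ω) : Fin n → S :=
  fun i => Z i ω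

/-- `X n = o_P(a n)`: for all `ε > 0`, the probability of `X n > ε a n` tends to zero.
A measure is applied to arbitrary sets as an outer measure, so that this is convergence in outer
probability when `X n` is not measurable. -/
def IsLittleOP {Ω : Type*} [MeasurableSpace Ω] (μ : Measure Ω)
    (X : ℕ → Ω → ℝ≥0∞) (a : ℕ → ℝ) : Prop :=
  ∀ ε : ℝ, 0 < ε →
    Tendsto (fun n => μ {ω | ENNReal.ofReal (ε * a n) < X n ω}) atTop (𝓝 0)

/-- The event `E n` holds with probability tending to one (that is, the outer probability of its
complement tends to zero). -/
def WithProbTendingToOne {Ω : Type*} [MeasurableSpace Ω] (μ : Measure Ω)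
    (E : ℕ → Ω → Prop) : Prop :=
  Tendsto (fun n => μ {ω | ¬ E n ω}) atTop (𝓝 0)

/-! ### Donsker and Glivenko–Cantelli classes -/

/-- The space `ℓ^∞(ι)` of bounded real functions on `ι`, with the supremum norm. -/
abbrev EllInfty (ι : Type*) : Type _ := lp (fun _ : ι => ℝ) ∞

instance instMeasurableSpaceEllInfty (ι : Type*) : MeasurableSpace (EllInfty ι) := borel _

instance instBorelSpaceEllInfty (ι : Type*) : BorelSpace (EllInfty ι) := ⟨rfl⟩

/-- The outer expectation of a bounded, possibly non-measurable, function. -/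
def outerExpectation {Ω : Type*} [MeasurableSpace Ω] (μ : Measure Ω) (h : Ω → ℝ) : ℝ :=
  sInf {a : ℝ | ∃ U : Ω → ℝ, Measurable U ∧ Integrable U μ ∧ (∀ ω, h ω ≤ U ω) ∧ a = ∫ ω, U ω ∂μ}

/-- `L` is the law of a tight `P`-Brownian bridge on `ℓ^∞(Φ)`: a tight Borel probability measure,
under which the coordinate process is mean-zero Gaussian with the covariance of the class `Φ`
under `P`. -/
def IsTightBrownianBridge {S : Type*} [MeasurableSpace S] (P : Measure S) (Φ : Set (S → ℝ))
    (L : Measure (EllInfty Φ)) : Prop :=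
  IsProbabilityMeasure L ∧ IsTightMeasureSet {L} ∧
    ∀ (s : Finset Φ) (c : Φ → ℝ),
      L.map (fun x : EllInfty Φ => ∑ φ ∈ s, c φ * x φ) =
        gaussianReal 0 (variance (fun z => ∑ φ ∈ s, c φ * φ.1 z) P).toNNReal

/-- `Φ` is `P`-Donsker: it consists of measurable square-integrable functions, the empirical
processes `√n (P_n - P)` of i.i.d. samples from `P` have bounded sample paths on `Φ`, and they
converge weakly in `ℓ^∞(Φ)` (in the sense of outer expectations of bounded continuous functions)
to a tight `P`-Brownian bridge. -/
def IsDonsker {S : Type*} [MeasurableSpace S] (P : Measure S) (Φ : Set (S → ℝ)) : Prop :=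
  (∀ φ ∈ Φ, Measurable φ ∧ MemLp φ 2 P) ∧
  ∃ (E : ∀ n : ℕ, (Fin n → S) → EllInfty Φ) (L : Measure (EllInfty Φ)),
    (∀ (n : ℕ) (z : Fin n → S) (φ : Φ),
      E n z φ = Real.sqrt n * (empMean z φ.1 - ∫ s, φ.1 s ∂P)) ∧
    IsTightBrownianBridge P Φ L ∧
    ∀ h : EllInfty Φ →ᵇ ℝ,
      Tendsto (fun n : ℕ => outerExpectation (Measure.pi fun _ : Fin n => P) (fun z => h (E n z)))
        atTop (𝓝 (∫ x, h x ∂L))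

/-- `Φ` is `P`-Glivenko–Cantelli: it consists of measurable integrable functions, and
`sup_{φ ∈ Φ} |P_n φ - P φ|` converges to zero outer almost surely, for an i.i.d. sequence
from `P`. -/
def IsGlivenkoCantelli {S : Type*} [MeasurableSpace S] (P : Measure S) [IsProbabilityMeasure P]
    (Φ : Set (S → ℝ)) : Prop :=
  (∀ φ ∈ Φ, Measurable φ ∧ Integrable φ P) ∧
  ∃ Δ : ℕ → (ℕ → S) → ℝ≥0∞,
    (∀ n, Measurable (Δ n)) ∧
    (∀ n z, ∀ φ ∈ Φ,
      ENNReal.ofReal |empMean (fun i : Fin n => z i) φ - ∫ s, φ s ∂P| ≤ Δ n z) ∧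
    ∀ᵐ z ∂(Measure.infinitePi fun _ : ℕ => P), Tendsto (fun n => Δ n z) atTop (𝓝 0)

/-! ### Uniform asymptotic linearity along the sub-models

Below, `𝔉` is the set of directions, `B` the range of the parameter `β`, `Gt n ω f β` an estimator
of the goodness-of-fit `G0 f β`, and `φ0 f z β` the influence function. -/

section Conditions

variable {Ω S D : Type*}

/-- The remainder `{G̃_{n,f}(β) - G_{0,f}(β)} - (1/n) ∑ᵢ φ_{0,f}(Zᵢ; β)`. -/
def remainder (Z : ℕ → Ω → S) (Gt : ℕ → Ω → D → ℝ → ℝ) (G0 : D → ℝ → ℝ)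
    (φ0 : D → S → ℝ → ℝ) (n : ℕ) (ω : Ω) (f : D) (β : ℝ) : ℝ :=
  (Gt n ω f β - G0 f β) - empMean (sample Z n ω) (fun z => φ0 f z β)

/-- The estimators along all sub-models agree at `β = 0`. -/
def AgreeAtZero (𝔉 : Set D) (Gt : ℕ → Ω → D → ℝ → ℝ) : Prop :=
  ∀ n ω, ∀ f₁ ∈ 𝔉, ∀ f₂ ∈ 𝔉, f₁ ≠ f₂ → Gt n ω f₁ 0 = Gt n ω f₂ 0

/-- Uniform asymptotic linearity of the estimator. -/
def UniformlyAsympLinear [MeasurableSpace Ω] (μ : Measure Ω) (Z : ℕ → Ω → S) (𝔉 : Set D) (B : Set ℝ)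
    (Gt : ℕ → Ω → D → ℝ → ℝ) (G0 : D → ℝ → ℝ) (φ0 : D → S → ℝ → ℝ) : Prop :=
  IsLittleOP μ
    (fun n ω => ⨆ f ∈ 𝔉, ⨆ β ∈ B, ENNReal.ofReal |remainder Z Gt G0 φ0 n ω f β|)
    (fun n => (n : ℝ) ^ (-(1 / 2) : ℝ))

/-- The estimator (and the remainder) is differentiable in `β`, and the derivative of
the remainder is uniformly of order `o_P(n^{-1/2})`. -/
def DerivAsympLinear [MeasurableSpace Ω] (μ : Measure Ω) (Z : ℕ → Ω → S) (𝔉 : Set D) (B : Set ℝ)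
    (Gt : ℕ → Ω → D → ℝ → ℝ) (G0 : D → ℝ → ℝ) (φ0 : D → S → ℝ → ℝ) : Prop :=
  (∀ n ω, ∀ f ∈ 𝔉, ∀ β ∈ B, DifferentiableAt ℝ (Gt n ω f) β ∧
    DifferentiableAt ℝ (remainder Z Gt G0 φ0 n ω f) β) ∧
  IsLittleOP μ
    (fun n ω => ⨆ f ∈ 𝔉, ⨆ β ∈ B, ENNReal.ofReal |deriv (remainder Z Gt G0 φ0 n ω f) β|)
    (fun n => (n : ℝ) ^ (-(1 / 2) : ℝ))

/-- The estimator (and the remainder) is twice differentiable in `β`, and the second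
derivative of the remainder is uniformly of order `o_P(1)`. -/
def SecondDerivConsistent [MeasurableSpace Ω] (μ : Measure Ω) (Z : ℕ → Ω → S) (𝔉 : Set D) (B : Set ℝ)
    (Gt : ℕ → Ω → D → ℝ → ℝ) (G0 : D → ℝ → ℝ) (φ0 : D → S → ℝ → ℝ) : Prop :=
  (∀ n ω, ∀ f ∈ 𝔉, ∀ β ∈ B, DifferentiableAt ℝ (deriv (Gt n ω f)) β ∧
    DifferentiableAt ℝ (deriv (remainder Z Gt G0 φ0 n ω f)) β) ∧
  IsLittleOP μ
    (fun n ω => ⨆ f ∈ 𝔉, ⨆ β ∈ B,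
      ENNReal.ofReal |deriv (deriv (remainder Z Gt G0 φ0 n ω f)) β|)
    (fun _ => 1)

end Conditions

/-! ### The nonparametric regression model -/

/-- The covariate space. -/
abbrev Cov (d₂ : ℕ) : Type := EuclideanSpace ℝ (Fin d₂)

/-- The space of predictors of interest. -/
abbrev Pred (d₁ : ℕ) : Type := EuclideanSpace ℝ (Fin d₁)

/-- Observations `z = (w, x, y)`. -/
abbrev Obs (d₁ d₂ : ℕ) : Type := Cov d₂ × (Pred d₁ × ℝ)

/-- Directions `f`, real functions of `(w, x)`. -/
abbrev Dir (d₁ d₂ : ℕ) : Type := Cov d₂ × Pred d₁ → ℝ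

variable {d₁ d₂ : ℕ}

/-- `μ_{P,Y}(w) = E_P[Y | W = w]`, computed with the regular conditional distribution of `(X, Y)`
given `W`. -/
def condMeanY (P : Measure (Obs d₁ d₂)) [IsFiniteMeasure P] (w : Cov d₂) : ℝ :=
  ∫ q, q.2 ∂(P.condKernel w)

/-- `μ_{P,f}(w) = E_P[f(W, X) | W = w]`. -/
def condMeanDir (P : Measure (Obs d₁ d₂)) [IsFiniteMeasure P] (f : Dir d₁ d₂) (w : Cov d₂) : ℝ :=
  ∫ q, f (w, q.1) ∂(P.condKernel w)

/-- The squared error `{y - m(w) - β f(w, x)}²`. -/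
def sqLoss (m : Cov d₂ → ℝ) (f : Dir d₁ d₂) (β : ℝ) (z : Obs d₁ d₂) : ℝ :=
  (z.2.2 - m z.1 - β * f (z.1, z.2.1)) ^ 2

/-- `G_{P,f}(β) = ∫ {y - μ_{P,Y}(w) - β f(w, x)}² dP`. -/
def goodnessOfFit (P : Measure (Obs d₁ d₂)) [IsFiniteMeasure P] (f : Dir d₁ d₂) (β : ℝ) : ℝ :=
  ∫ z, sqLoss (condMeanY P) f β z ∂P

/-- `{y - m(w) - β f(w,x)}² + 2 β {y - m(w)} m_f(w) - G(β)`: the influence function of the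
goodness-of-fit at nuisance values `m`, `m_f`, `G`. -/
def influence (m mf : Cov d₂ → ℝ) (G : ℝ → ℝ) (f : Dir d₁ d₂) (z : Obs d₁ d₂) (β : ℝ) : ℝ :=
  sqLoss m f β z + 2 * β * (z.2.2 - m z.1) * mf z.1 - G β

/-- The efficient influence function `φ_{P,f}(z; β)` of `G_{P,f}(β)`. -/
def effInfluence (P : Measure (Obs d₁ d₂)) [IsFiniteMeasure P] (f : Dir d₁ d₂)
    (z : Obs d₁ d₂) (β : ℝ) : ℝ :=
  influence (condMeanY P) (condMeanDir P f) (goodnessOfFit P f) f z β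

section Estimators

variable {Ω : Type*} (Z : ℕ → Ω → Obs d₁ d₂) (mY : ℕ → Ω → Cov d₂ → ℝ)
  (mF : ℕ → Ω → Dir d₁ d₂ → Cov d₂ → ℝ)

/-- The plug-in estimator `G_{n,f}(β) = (1/n) ∑ᵢ {Yᵢ - μ_{n,Y}(Wᵢ) - β f(Wᵢ, Xᵢ)}²`. -/
def plugIn (n : ℕ) (ω : Ω) (f : Dir d₁ d₂) (β : ℝ) : ℝ :=
  empMean (sample Z n ω) (sqLoss (mY n ω) f β)

/-- The estimated influence function `φ_{n,f}(z; β)`. -/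
def estInfluence (n : ℕ) (ω : Ω) (f : Dir d₁ d₂) (z : Obs d₁ d₂) (β : ℝ) : ℝ :=
  influence (mY n ω) (mF n ω f) (plugIn Z mY n ω f) f z β

/-- The one-step estimator `G̃_{n,f}(β) = G_{n,f}(β) + (1/n) ∑ᵢ φ_{n,f}(Zᵢ; β)`. -/
def oneStep (n : ℕ) (ω : Ω) (f : Dir d₁ d₂) (β : ℝ) : ℝ :=
  plugIn Z mY n ω f β + empMean (sample Z n ω) (fun z => estInfluence Z mY mF n ω f z β)

end Estimators

end ImprovementInFit

end

noncomputable section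

namespace ImprovementInFit

/-! ### Events of probability tending to one -/

section WithProbTendingToOne

variable {Ω : Type*} [MeasurableSpace Ω] {μ : Measure Ω}

/-! Write P_n for the empirical mean, e = y - μ_Y and d = μ_Y - m, with m the estimator of μ_Y. In
the one-step estimator the plug-in term cancels, and the coefficient of β² is P_n f², in which no
nuisance occurs. For n ≠ 0 the remainder is therefore affine in β, with intercept P_n `baseDiff` and
slope P_n `slopeDiff` (`remainder_eq`). Its second derivative vanishes, and it remains to show that
intercept and slope are o_P(n^{-1/2}), uniformly in f.

Residuals are orthogonal to functions of w, so the P₀-means of the two functions are ∫ d² and -2 ∫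
(μ_f - m_f) d (`integral_baseDiff`, `integral_slopeDiff`); the rate hypotheses control both. What is
left is the empirical process at random members of a Donsker class. Asymptotic equicontinuity makes
it negligible once the variances of these members vanish uniformly
(`IsDonsker.withProbTendingToOne_abs_le`).

The variances are the difficulty: e (m_f - μ_f) is a priori small only in L¹, and d (f - μ_f) is not
even that, since the f are not uniformly bounded in any norm. The remedy is compactness
(`exists_variance_le`). A Donsker class is totally bounded in L² modulo constants, so products d_k
u_k have an L² limit H along a subsequence. Where H ≠ 0 the factors u_k must blow up, because d_k →
0. But class membership holds for all f with the same d, so for fixed j the products d_j u_k are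
bounded in L¹ too, and Fatou's lemma forbids the blow-up. Hence H = 0. -/

theorem WithProbTendingToOne.and {E F : ℕ → Ω → Prop} (hE : WithProbTendingToOne μ E)
    (hF : WithProbTendingToOne μ F) : WithProbTendingToOne μ (fun n ω => E n ω ∧ F n ω) := by
  have h : Tendsto (fun n => μ {ω | ¬ E n ω} + μ {ω | ¬ F n ω}) atTop (𝓝 0) := by
    simpa using hE.add hF
  refine tendsto_of_tendsto_of_tendsto_of_le_of_le tendsto_const_nhds h (fun _ => zero_le) ?_
  intro n
  refine (measure_mono ?_).trans (measure_union_le _ _)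
  intro ω hω
  by_contra h
  simp only [Set.mem_union, Set.mem_ofPred_eq, not_or, not_not] at h hω
  exact hω h

theorem WithProbTendingToOne.mono {E F : ℕ → Ω → Prop} (hE : WithProbTendingToOne μ E)
    (h : ∀ᶠ n in atTop, ∀ ω, E n ω → F n ω) : WithProbTendingToOne μ F := by
  refine tendsto_of_tendsto_of_tendsto_of_le_of_le' tendsto_const_nhds hE
    (Eventually.of_forall fun _ => zero_le) ?_
  filter_upwards [h] with n hn
  exact measure_mono fun ω hω hE => hω (hn ω hE)

theorem isLittleOP_iff {X : ℕ → Ω → ℝ≥0∞} {a : ℕ → ℝ} :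
    IsLittleOP μ X a ↔
      ∀ ε : ℝ, 0 < ε → WithProbTendingToOne μ fun n ω => X n ω ≤ ENNReal.ofReal (ε * a n) := by
  simp only [IsLittleOP, WithProbTendingToOne, not_le]

end WithProbTendingToOne

/-! ### Consequences of the Donsker property -/

section Donsker

variable {S : Type*} [MeasurableSpace S] {P : Measure S} {Φ : Set (S → ℝ)}

theorem EllInfty.abs_apply_sub_le {ι : Type*} (x y : EllInfty ι) (i : ι) :
    |x i - y i| ≤ dist x y := by
  rw [dist_eq_norm]
  exact lp.norm_apply_le_norm ENNReal.top_ne_zero (x - y) i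

theorem EllInfty.continuous_apply {ι : Type*} (i : ι) : Continuous fun x : EllInfty ι => x i := by
  refine (LipschitzWith.of_dist_le_mul (K := 1) fun x y => ?_).continuous
  simpa [Real.dist_eq] using EllInfty.abs_apply_sub_le x y i

/-- Anti-concentration, from the bound 1/√v on the density: a bridge coordinate of large variance
cannot stay in a short interval on a set of large measure. -/
theorem gaussianReal_Icc_le (v : NNReal) (hv : v ≠ 0) (a : ℝ) :
    gaussianReal 0 v (Set.Icc (-a) a) ≤ ENNReal.ofReal (2 * a / √v) := by
  have hv' : (0 : ℝ) < v := by positivity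
  rw [gaussianReal_apply 0 hv]
  have : ∀ x, gaussianPDF 0 v x ≤ ENNReal.ofReal (1 / √v) := by
    intro x
    refine ENNReal.ofReal_le_ofReal ?_
    rw [gaussianPDFReal]
    have h1 : Real.exp (-(x - 0) ^ 2 / (2 * v)) ≤ 1 := by
      rw [Real.exp_le_one_iff]
      exact div_nonpos_of_nonpos_of_nonneg (by nlinarith [sq_nonneg (x - 0)]) (by positivity)
    have h2 : (√(2 * Real.pi * v))⁻¹ ≤ 1 / √v := by
      rw [one_div]
      refine inv_anti₀ (by positivity) (Real.sqrt_le_sqrt ?_)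
      nlinarith [Real.pi_gt_three]
    calc _ ≤ (√(2 * Real.pi * v))⁻¹ * 1 := by gcongr
      _ ≤ _ := by simpa using h2
  calc _ ≤ ∫⁻ _ in Set.Icc (-a) a, ENNReal.ofReal (1 / √v) := lintegral_mono this
    _ = ENNReal.ofReal (2 * a / √v) := by
      rw [setLIntegral_const, Real.volume_Icc, ← ENNReal.ofReal_mul (by positivity)]
      congr 1; ring

theorem IsTightBrownianBridge.map_apply {L : Measure (EllInfty Φ)}
    (h : IsTightBrownianBridge P Φ L) (φ : Φ) :
    L.map (fun x : EllInfty Φ => x φ) = gaussianReal 0 (variance φ.1 P).toNNReal := by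
  simpa using h.2.2 {φ} (fun _ => 1)

theorem IsTightBrownianBridge.map_sub {L : Measure (EllInfty Φ)}
    (h : IsTightBrownianBridge P Φ L) {φ ψ : Φ} (hne : φ ≠ ψ) :
    L.map (fun x : EllInfty Φ => x φ - x ψ) =
      gaussianReal 0 (variance (fun z => φ.1 z - ψ.1 z) P).toNNReal := by
  classical
  have := h.2.2 {φ, ψ} (fun χ => if χ = φ then 1 else -1)
  simpa [Finset.sum_pair hne, hne.symm, sub_eq_add_neg] using this

theorem gaussianReal_le_abs_le (v : NNReal) {ε : ℝ} (hε : 0 < ε) :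
    gaussianReal 0 v {x | ε ≤ |x|} ≤ ENNReal.ofReal (v / ε ^ 2) := by
  simpa using meas_ge_le_variance_div_sq (μ := gaussianReal 0 v) (X := id)
    (memLp_id_gaussianReal' 2 (by simp)) hε

theorem IsTightBrownianBridge.exists_isCompact {L : Measure (EllInfty Φ)}
    (h : IsTightBrownianBridge P Φ L) {η : ℝ≥0∞} (hη : 0 < η) :
    ∃ K : Set (EllInfty Φ), IsCompact K ∧ L Kᶜ ≤ η := by
  obtain ⟨K, hK, hKL⟩ := isTightMeasureSet_iff_exists_isCompact_measure_compl_le.1 h.2.1 η hη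
  exact ⟨K, hK, hKL L rfl⟩

/-- The bridge is uniformly small at functions of small variance. -/
theorem IsTightBrownianBridge.exists_measure_le {L : Measure (EllInfty Φ)}
    (h : IsTightBrownianBridge P Φ L) {ε : ℝ} (hε : 0 < ε) {η : ℝ≥0∞} (hη : 0 < η) :
    ∃ ρ : ℝ, 0 < ρ ∧ L {x | ∃ φ : Φ, variance φ.1 P ≤ ρ ∧ ε ≤ |x φ|} ≤ η := by
  have hη2 : 0 < η / 2 := ENNReal.half_pos hη.ne'
  obtain ⟨K, hK, hKL⟩ := h.exists_isCompact hη2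
  obtain ⟨t, -, htfin, ht⟩ := finite_cover_balls_of_compact hK (show 0 < ε / 4 by positivity)
  lift t to Finset (EllInfty Φ) using htfin
  -- The mass allowed to each ball. With variance at most c ε²/4, Chebyshev's inequality at level
  -- ε/2 gives exactly c.
  obtain ⟨c, hc0, hc⟩ := ENNReal.exists_nnreal_pos_mul_lt (a := (t.card : ℝ≥0∞)) (by simp) hη2.ne'
  have hc0' : (0 : ℝ) < c := hc0
  set F : Set (EllInfty Φ) := {x | ∃ φ : Φ, variance φ.1 P ≤ c * ε ^ 2 / 4 ∧ ε ≤ |x φ|} with hF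
  refine ⟨c * ε ^ 2 / 4, by positivity, ?_⟩
  -- One function per ball suffices: if φ is a witness for some x₀ in the ball, every x there is
  -- within ε/2 of x₀, hence |x φ| ≥ ε/2.
  have hball : ∀ y ∈ t, L (Metric.ball y (ε / 4) ∩ F) ≤ c := by
    intro y _
    rcases (Metric.ball y (ε / 4) ∩ F).eq_empty_or_nonempty with he | ⟨x₀, hx₀, φ, hφ, hφx⟩
    · simp [he]
    have hsub : Metric.ball y (ε / 4) ∩ F ⊆ (fun x : EllInfty Φ => x φ) ⁻¹' {r | ε / 2 ≤ |r|} := by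
      rintro x ⟨hx, -⟩
      have h1 : dist x x₀ < ε / 4 + ε / 4 :=
        (dist_triangle_right x x₀ y).trans_lt (add_lt_add hx hx₀)
      have h2 := EllInfty.abs_apply_sub_le x₀ x φ
      rw [dist_comm] at h2
      have h3 := abs_sub_abs_le_abs_sub (x₀ φ) (x φ)
      simp only [Set.mem_preimage, Set.mem_ofPred_eq]
      linarith
    refine (measure_mono hsub).trans ?_
    have hmap := Measure.map_apply (μ := L) (EllInfty.continuous_apply φ).measurable
      (measurableSet_le measurable_const measurable_norm : MeasurableSet {r : ℝ | ε / 2 ≤ |r|})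
    rw [h.map_apply] at hmap
    refine hmap.symm.le.trans ?_
    refine (gaussianReal_le_abs_le _ (by positivity)).trans ?_
    rw [Real.coe_toNNReal _ (variance_nonneg _ _)]
    refine (ENNReal.ofReal_le_ofReal (q := c) ?_).trans (by simp)
    rw [div_le_iff₀ (by positivity)]
    linarith
  have hcover : F ⊆ Kᶜ ∪ ⋃ y ∈ t, (Metric.ball y (ε / 4) ∩ F) := by
    intro x hx
    by_cases hxK : x ∈ K
    · right
      have := ht hxK
      simp only [Set.mem_iUnion, Finset.mem_coe] at this ⊢
      obtain ⟨y, hy, hxy⟩ := this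
      exact ⟨y, hy, hxy, hx⟩
    · exact Or.inl hxK
  calc L F ≤ L Kᶜ + L (⋃ y ∈ t, (Metric.ball y (ε / 4) ∩ F)) :=
        (measure_mono hcover).trans (measure_union_le _ _)
    _ ≤ η / 2 + ∑ y ∈ t, (c : ℝ≥0∞) := by
        gcongr
        exact (measure_biUnion_finset_le _ _).trans (Finset.sum_le_sum hball)
    _ ≤ η / 2 + η / 2 := by
        gcongr
        rw [Finset.sum_const, nsmul_eq_mul, mul_comm]
        exact hc.le
    _ = η := ENNReal.add_halves η

/-- The classes modulo `P`-null functions of the centred functions `φ - Pφ`, `φ ∈ Φ`. -/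
def centredClass (P : Measure S) (Φ : Set (S → ℝ)) : Set (Lp ℝ 2 P) :=
  {g | ∃ φ ∈ Φ, g =ᵐ[P] fun z => φ z - ∫ s, φ s ∂P}

theorem norm_sq_eq_variance {φ : S → ℝ} (hφ : AEMeasurable φ P) {g : Lp ℝ 2 P}
    (hg : g =ᵐ[P] fun z => φ z - ∫ s, φ s ∂P) : ‖g‖ ^ 2 = variance φ P := by
  rw [← real_inner_self_eq_norm_sq, L2.inner_def, variance_eq_integral hφ]
  refine integral_congr_ae ?_
  filter_upwards [hg] with z hz
  simp [hz, sq]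

theorem dist_sq_eq_variance [IsFiniteMeasure P] {φ ψ : S → ℝ} (hφ : MemLp φ 2 P) (hψ : MemLp ψ 2 P)
    {g h : Lp ℝ 2 P} (hg : g =ᵐ[P] fun z => φ z - ∫ s, φ s ∂P)
    (hh : h =ᵐ[P] fun z => ψ z - ∫ s, ψ s ∂P) :
    dist g h ^ 2 = variance (fun z => φ z - ψ z) P := by
  rw [dist_eq_norm]
  refine norm_sq_eq_variance (φ := fun z => φ z - ψ z) (hφ.sub hψ).1.aemeasurable ?_
  rw [integral_sub (hφ.integrable (by norm_num)) (hψ.integrable (by norm_num))]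
  filter_upwards [hg, hh, Lp.coeFn_sub g h] with z h1 h2 h3
  rw [h3, Pi.sub_apply, h1, h2]
  ring

/-- A class that carries a tight Brownian bridge is totally bounded for the `L²` distance of its
centred functions. -/
theorem IsTightBrownianBridge.totallyBounded [IsFiniteMeasure P] {L : Measure (EllInfty Φ)}
    (h : IsTightBrownianBridge P Φ L) (hΦ : ∀ φ ∈ Φ, MemLp φ 2 P) :
    TotallyBounded (centredClass P Φ) := by
  classical
  have := h.1
  rw [Metric.totallyBounded_iff]
  intro ε hε
  -- Chosen so that an interval of half-width 3r has mass at most 6r/ε = 1/4 under a centred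
  -- Gaussian of standard deviation at least ε.
  set r := ε / 24 with hr
  have hr0 : 0 < r := by positivity
  obtain ⟨K, hK, hKL⟩ := h.exists_isCompact (η := 1 / 4) (by simp)
  obtain ⟨t, -, htfin, ht⟩ := finite_cover_balls_of_compact hK hr0
  have : Fintype t := htfin.fintype
  -- Evaluation at the finitely many centres of a net of K. Its range is bounded in a
  -- finite-dimensional space, and closeness there will force closeness in variance.
  let V : Φ → (t → ℝ) := fun φ x => x.1 φ
  have hV : TotallyBounded (Set.range V) := by
    have hbdd : Bornology.IsBounded (Set.range V) := by
      refine (Metric.isBounded_iff_subset_closedBall (0 : t → ℝ)).2 ⟨∑ x : t, ‖x.1‖, ?_⟩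
      rintro _ ⟨φ, rfl⟩
      rw [mem_closedBall_zero_iff, pi_norm_le_iff_of_nonneg (by positivity)]
      intro x
      exact (lp.norm_apply_le_norm ENNReal.top_ne_zero x.1 φ).trans
        (Finset.single_le_sum (f := fun x : t => ‖x.1‖) (fun _ _ => norm_nonneg _)
          (Finset.mem_univ x))
    obtain ⟨C, -, hC⟩ := hbdd.exists_pos_norm_le
    exact (isCompact_closedBall (0 : t → ℝ) C).totallyBounded.subset fun v hv =>
      mem_closedBall_zero_iff.2 (hC v hv)
  have hclose : ∀ φ ψ : Φ, dist (V φ) (V ψ) < r →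
      variance (fun z => φ.1 z - ψ.1 z) P < ε ^ 2 := by
    intro φ ψ hd
    by_cases hne : φ = ψ
    · subst hne
      simp only [sub_self]
      have : variance (fun _ : S => (0 : ℝ)) P = 0 := variance_zero P
      rw [this]; positivity
    by_contra! hv
    -- Each x in K is within r of a centre, so the increment at x is at most r + r + r. If the
    -- variance were large, K would have mass at most 1/4, and so does its complement.
    have hsub : K ⊆ (fun x : EllInfty Φ => x φ - x ψ) ⁻¹' Set.Icc (-(3 * r)) (3 * r) := by
      intro x hx
      have := ht hx
      simp only [Set.mem_iUnion] at this
      obtain ⟨y, hy, hxy⟩ := this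
      rw [Metric.mem_ball] at hxy
      have h1 := EllInfty.abs_apply_sub_le x y φ
      have h2 := EllInfty.abs_apply_sub_le x y ψ
      have h3 : |y φ - y ψ| ≤ dist (V φ) (V ψ) := dist_le_pi_dist (V φ) (V ψ) ⟨y, hy⟩
      rw [abs_le] at h1 h2 h3
      constructor <;> dsimp only <;> linarith
    have hmeas : L K ≤ ENNReal.ofReal (1 / 4) := by
      refine (measure_mono hsub).trans ?_
      have hcont : Continuous fun x : EllInfty Φ => x φ - x ψ :=
        (EllInfty.continuous_apply φ).sub (EllInfty.continuous_apply ψ)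
      have hmap := Measure.map_apply (μ := L) hcont.measurable
        (measurableSet_Icc (a := -(3 * r)) (b := 3 * r))
      rw [h.map_sub hne] at hmap
      refine hmap.symm.le.trans ?_
      have hv0 : 0 < variance (fun z => φ.1 z - ψ.1 z) P := lt_of_lt_of_le (by positivity) hv
      refine (gaussianReal_Icc_le _ (by simpa using hv0) _).trans (ENNReal.ofReal_le_ofReal ?_)
      rw [Real.coe_toNNReal _ hv0.le]
      have : ε ≤ √(variance (fun z => φ.1 z - ψ.1 z) P) := Real.le_sqrt_of_sq_le hv
      rw [div_le_iff₀ (by positivity)]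
      linarith
    have h1 : (1 : ℝ≥0∞) ≤ L K + L Kᶜ := by
      rw [← measure_univ (μ := L), ← Set.union_compl_self K]
      exact measure_union_le _ _
    have h2 : L K + L Kᶜ ≤ 1 / 2 := by
      refine (add_le_add hmeas hKL).trans ?_
      rw [show (1 / 4 : ℝ≥0∞) = ENNReal.ofReal (1 / 4) by
        rw [ENNReal.ofReal_div_of_pos (by norm_num)]; simp, ← ENNReal.ofReal_add (by norm_num) (by norm_num),
        show (1 / 2 : ℝ≥0∞) = ENNReal.ofReal (1 / 2) by
        rw [ENNReal.ofReal_div_of_pos (by norm_num)]; simp]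
      exact ENNReal.ofReal_le_ofReal (by norm_num)
    have h3 := h1.trans h2
    norm_num at h3
  obtain ⟨s, hsV, hsfin, hs⟩ := Metric.finite_approx_of_totallyBounded hV r hr0
  choose q hq using fun v : s => hsV v.2
  have := hsfin.to_subtype
  let c : Φ → Lp ℝ 2 P := fun φ => ((hΦ φ.1 φ.2).sub (memLp_const (∫ s, φ.1 s ∂P))).toLp
  have hc : ∀ φ : Φ, c φ =ᵐ[P] fun z => φ.1 z - ∫ s, φ.1 s ∂P := fun φ => MemLp.coeFn_toLp _
  refine ⟨Set.range fun v => c (q v), Set.finite_range _, ?_⟩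
  rintro g ⟨φ, hφ, hg⟩
  have := hs ⟨⟨φ, hφ⟩, rfl⟩
  simp only [Set.mem_iUnion] at this
  obtain ⟨v, hv, hφv⟩ := this
  simp only [Set.mem_iUnion]
  refine ⟨c (q ⟨v, hv⟩), ⟨⟨v, hv⟩, rfl⟩, ?_⟩
  rw [Metric.mem_ball]
  refine lt_of_pow_lt_pow_left₀ 2 hε.le ?_
  rw [dist_sq_eq_variance (hΦ φ hφ) (hΦ _ (q ⟨v, hv⟩).2) hg (hc _)]
  refine hclose ⟨φ, hφ⟩ (q ⟨v, hv⟩) ?_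
  rw [hq ⟨v, hv⟩]
  exact hφv

/-- The empirical process of a Donsker class is uniformly small at functions of small variance. -/
theorem IsDonsker.eventually_measure_le [IsProbabilityMeasure P] (h : IsDonsker P Φ) {ε : ℝ}
    (hε : 0 < ε) {η : ℝ≥0∞} (hη : 0 < η) :
    ∃ ρ : ℝ, 0 < ρ ∧ ∀ᶠ n : ℕ in atTop, Measure.pi (fun _ : Fin n => P)
      {z | ∃ φ ∈ Φ, variance φ P ≤ ρ ∧ ε < |√n * (empMean z φ - ∫ s, φ s ∂P)|} ≤ η := by
  -- This makes η finite, so that it can be compared with real integrals.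
  wlog hη1 : η ≤ 1 generalizing η
  · obtain ⟨ρ, h0, hρ⟩ := this (η := 1) one_pos le_rfl
    exact ⟨ρ, h0, hρ.mono fun n hn => hn.trans (not_le.1 hη1).le⟩
  obtain ⟨-, E, L, hE, hL, hconv⟩ := h
  have := hL.1
  have hη2 : 0 < η / 2 := ENNReal.half_pos hη.ne'
  have hηtop : η ≠ ∞ := (hη1.trans_lt ENNReal.one_lt_top).ne
  obtain ⟨ρ, hρ0, hρ⟩ := hL.exists_measure_le (show 0 < ε / 2 by positivity) hη2
  refine ⟨ρ, hρ0, ?_⟩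
  set F : Set (EllInfty Φ) := {x | ∃ φ : Φ, variance φ.1 P ≤ ρ ∧ ε ≤ |x φ|} with hF
  set F' : Set (EllInfty Φ) := {x | ∃ φ : Φ, variance φ.1 P ≤ ρ ∧ ε / 2 ≤ |x φ|} with hF'
  have hth : Metric.thickening (ε / 2) F ⊆ F' := by
    intro x hx
    obtain ⟨y, ⟨φ, hφ, hy⟩, hxy⟩ := Metric.mem_thickening_iff.1 hx
    refine ⟨φ, hφ, ?_⟩
    have h2 := EllInfty.abs_apply_sub_le y x φ
    rw [dist_comm] at h2
    have h3 := abs_sub_abs_le_abs_sub (y φ) (x φ)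
    linarith
  -- A continuous function between the indicators of F and F', as in the portmanteau theorem: weak
  -- convergence applies to it although F and F' need not be measurable.
  let k : EllInfty Φ →ᵇ NNReal := thickenedIndicator (show 0 < ε / 2 by positivity) F
  let k' : EllInfty Φ →ᵇ ℝ := BoundedContinuousFunction.comp _ (LipschitzWith.subtype_val _) k
  have hk' : ∀ x, k' x = k x := fun x => rfl
  have hk1 : ∀ x, k x ≤ 1 := thickenedIndicator_le_one _ F
  have hint : ∫ x, k' x ∂L ≤ (η / 2).toReal := by
    rw [integral_eq_lintegral_of_nonneg_ae (f := fun x => k' x) (Eventually.of_forall fun x => (k x).2)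
      k'.continuous.measurable.aestronglyMeasurable]
    refine ENNReal.toReal_mono (ENNReal.div_ne_top hηtop (by simp)) ?_
    calc ∫⁻ x, ENNReal.ofReal (k' x) ∂L
        ≤ ∫⁻ x, (toMeasurable L F').indicator 1 x ∂L := by
          refine lintegral_mono fun x => ?_
          by_cases hx : x ∈ Metric.thickening (ε / 2) F
          · rw [Set.indicator_of_mem (subset_toMeasurable _ _ (hth hx)), hk']
            simpa using hk1 x
          · have : k x = 0 := thickenedIndicator_zero _ _ hx
            rw [hk', this]
            simp
      _ = L F' := by rw [lintegral_indicator_one (measurableSet_toMeasurable _ _),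
            measure_toMeasurable]
      _ ≤ η / 2 := hρ
  have hlt : ∫ x, k' x ∂L < η.toReal := by
    refine hint.trans_lt ((ENNReal.toReal_lt_toReal (ENNReal.div_ne_top hηtop (by simp)) hηtop).2 ?_)
    exact ENNReal.half_lt_self hη.ne' hηtop
  filter_upwards [(hconv k').eventually (gt_mem_nhds hlt)] with n hn
  -- A measurable majorant nearly attaining the outer expectation; Markov's inequality is applied to
  -- it.
  obtain ⟨a, ⟨U, hU, hUi, hkU, rfl⟩, haη⟩ : ∃ a ∈ {a : ℝ | ∃ U : (Fin n → S) → ℝ, Measurable U ∧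
      Integrable U (Measure.pi fun _ : Fin n => P) ∧ (∀ z, k' (E n z) ≤ U z) ∧
      a = ∫ z, U z ∂(Measure.pi fun _ : Fin n => P)}, a < η.toReal := by
    refine exists_lt_of_csInf_lt ?_ hn
    exact ⟨_, fun _ => 1, measurable_const, integrable_const _, fun z => by
      rw [hk']; exact_mod_cast hk1 _, rfl⟩
  have hU0 : ∀ z, 0 ≤ U z := fun z => (k (E n z)).2.trans (hkU z)
  have hsub : {z : Fin n → S | ∃ φ ∈ Φ, variance φ P ≤ ρ ∧
      ε < |√n * (empMean z φ - ∫ s, φ s ∂P)|} ⊆ {z | 1 ≤ ENNReal.ofReal (U z)} := by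
    rintro z ⟨φ, hφ, hv, hz⟩
    have hmem : E n z ∈ F := ⟨⟨φ, hφ⟩, hv, by rw [hE]; exact hz.le⟩
    have : k (E n z) = 1 := thickenedIndicator_one _ _ hmem
    have h1 := hkU z
    rw [hk', this] at h1
    simpa using h1
  calc _ ≤ _ := measure_mono hsub
    _ ≤ ∫⁻ z, ENNReal.ofReal (U z) ∂(Measure.pi fun _ : Fin n => P) := by
      simpa using mul_meas_ge_le_lintegral (μ := Measure.pi fun _ : Fin n => P)
        hU.ennreal_ofReal 1
    _ = ENNReal.ofReal (∫ z, U z ∂(Measure.pi fun _ : Fin n => P)) :=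
      (ofReal_integral_eq_lintegral_ofReal hUi (Eventually.of_forall hU0)).symm
    _ ≤ η := ENNReal.ofReal_le_of_le_toReal haη.le

/-- The outer law of the first `n` terms of an i.i.d. sequence is at most the product law. -/
theorem measure_sample_le {Ω : Type*} [MeasurableSpace Ω] {μ : Measure Ω} [IsProbabilityMeasure μ]
    [IsProbabilityMeasure P] {Z : ℕ → Ω → S} (hZ : ∀ i, Measurable (Z i)) (hindep : iIndepFun Z μ)
    (hlaw : ∀ i, μ.map (Z i) = P) (n : ℕ) (A : Set (Fin n → S)) :
    μ {ω | sample Z n ω ∈ A} ≤ Measure.pi (fun _ : Fin n => P) A := by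
  have hmap : μ.map (sample Z n) = Measure.pi (fun _ : Fin n => P) := by
    have := (iIndepFun_iff_map_fun_eq_pi_map
      (f := fun i : Fin n => Z i) (fun i => (hZ i).aemeasurable)).1
      (hindep.precomp Fin.val_injective)
    simp only [hlaw] at this
    exact this
  have hmeas : Measurable (sample Z n) := measurable_pi_lambda _ fun i => hZ i
  rw [← measure_toMeasurable A, ← hmap, Measure.map_apply hmeas (measurableSet_toMeasurable _ _)]
  refine measure_mono fun ω hω => ?_
  exact subset_toMeasurable _ _ hω

/-- Asymptotic equicontinuity: the empirical process of a Donsker class tends to zero in outer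
probability along random subsets whose functions have uniformly vanishing variances. -/
theorem IsDonsker.withProbTendingToOne_abs_le {Ω : Type*} [MeasurableSpace Ω] {μ : Measure Ω}
    [IsProbabilityMeasure μ] [IsProbabilityMeasure P] {Z : ℕ → Ω → S} (hZ : ∀ i, Measurable (Z i))
    (hindep : iIndepFun Z μ) (hlaw : ∀ i, μ.map (Z i) = P) (h : IsDonsker P Φ)
    {A : ℕ → Ω → Set (S → ℝ)}
    (hA : ∀ ρ : ℝ, 0 < ρ → WithProbTendingToOne μ fun n ω =>
      ∀ φ ∈ A n ω, φ ∈ Φ ∧ variance φ P ≤ ρ) {ε : ℝ} (hε : 0 < ε) :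
    WithProbTendingToOne μ fun n ω =>
      ∀ φ ∈ A n ω, |√n * (empMean (sample Z n ω) φ - ∫ s, φ s ∂P)| ≤ ε := by
  rw [WithProbTendingToOne, ENNReal.tendsto_nhds_zero]
  intro η hη
  have hη2 : 0 < η / 2 := ENNReal.half_pos hη.ne'
  obtain ⟨ρ, hρ0, hρ⟩ := h.eventually_measure_le hε hη2
  filter_upwards [hρ, ENNReal.tendsto_nhds_zero.1 (hA ρ hρ0) _ hη2] with n h1 h2
  refine le_trans ?_ ((add_le_add h2 ((measure_sample_le hZ hindep hlaw n _).trans h1)).trans_eq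
    (ENNReal.add_halves η))
  refine (measure_mono ?_).trans (measure_union_le _ _)
  intro ω hω
  by_cases hgood : ∀ φ ∈ A n ω, φ ∈ Φ ∧ variance φ P ≤ ρ
  · right
    simp only [Set.mem_ofPred_eq, not_forall, not_le] at hω
    obtain ⟨φ, hφ, hlt⟩ := hω
    exact ⟨φ, (hgood φ hφ).1, (hgood φ hφ).2, hlt⟩
  · exact Or.inl hgood

theorem IsDonsker.totallyBounded [IsFiniteMeasure P] (h : IsDonsker P Φ) :
    TotallyBounded (centredClass P Φ) := by
  obtain ⟨hΦ, E, L, -, hL, -⟩ := h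
  exact hL.totallyBounded fun φ hφ => (hΦ φ hφ).2

end Donsker

/-! ### Vanishing variances by compactness in L² -/

section Variance

variable {S : Type*} [MeasurableSpace S] {P : Measure S} {Φ : Set (S → ℝ)}

/-- If H ≠ 0, then |u k| ≥ |H| / (2 |d k|) eventually, which tends to infinity; for one fixed j with
d j ≠ 0 so does |d j * u k|. -/
theorem eq_zero_of_tendsto_mul {d u : ℕ → ℝ} {H : ℝ} (hd : Tendsto d atTop (𝓝 0))
    (hdu : Tendsto (fun k => d k * u k) atTop (𝓝 H))
    (hbdd : ∀ j, liminf (fun k => ‖d j * u k‖ₑ) atTop < ∞) : H = 0 := by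
  by_contra hH
  have hH0 : 0 < |H| := abs_pos.2 hH
  have hev : ∀ᶠ k in atTop, |H| / 2 < |d k * u k| :=
    hdu.abs.eventually (lt_mem_nhds (half_lt_self hH0))
  obtain ⟨j, hj⟩ := hev.exists
  have hdj : d j ≠ 0 := by
    rintro h
    rw [h, zero_mul, abs_zero] at hj
    linarith
  have hne : ∀ᶠ k in atTop, d k ≠ 0 := by
    filter_upwards [hev] with k hk h
    rw [h, zero_mul, abs_zero] at hk
    linarith
  have hinv : Tendsto (fun k => |d j| * (|H| / 2) * |d k|⁻¹) atTop atTop := by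
    refine Tendsto.const_mul_atTop (by positivity) ?_
    refine tendsto_inv_nhdsGT_zero.comp (tendsto_nhdsWithin_iff.2 ⟨by simpa using hd.abs, ?_⟩)
    filter_upwards [hne] with k hk using abs_pos.2 hk
  have htop : Tendsto (fun k => ‖d j * u k‖ₑ) atTop (𝓝 ∞) := by
    have h1 : Tendsto (fun k => |d j * u k|) atTop atTop := by
      refine tendsto_atTop_mono' _ ?_ hinv
      filter_upwards [hev, hne] with k hk hk0
      rw [abs_mul] at hk ⊢
      rw [← div_eq_mul_inv, div_le_iff₀ (abs_pos.2 hk0)]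
      nlinarith [abs_pos.2 hdj]
    simpa only [Real.enorm_eq_ofReal_abs] using! ENNReal.tendsto_ofReal_atTop.comp h1
  exact (hbdd j).ne htop.liminf_eq

/-- If, for all `f`, the function `d * u f + R f - c f` belongs to a class `Φ` that is totally
bounded in `L²` modulo constants, and if `d` and, uniformly, `R f` are small in `L¹`, then the
variances of these functions are uniformly small. No bound on the functions `u f` is needed. -/
theorem exists_variance_le [IsProbabilityMeasure P] (hΦ : ∀ φ ∈ Φ, MemLp φ 2 P)
    (hT : TotallyBounded (centredClass P Φ)) {D : Type*} (𝔉 : Set D) (u : D → S → ℝ)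
    (hu : ∀ f ∈ 𝔉, Measurable (u f)) {ε : ℝ} (hε : 0 < ε) :
    ∃ δ : ℝ, 0 < δ ∧ ∀ (d : S → ℝ) (R : D → S → ℝ) (c : D → ℝ), Measurable d →
      eLpNorm d 1 P ≤ ENNReal.ofReal δ →
      (∀ f ∈ 𝔉, Measurable (R f) ∧ eLpNorm (R f) 1 P ≤ ENNReal.ofReal δ ∧
        Integrable (fun z => d z * u f z) P ∧ ∫ z, d z * u f z ∂P = 0 ∧
        (fun z => d z * u f z + R f z - c f) ∈ Φ) →
      ∀ f ∈ 𝔉, variance (fun z => d z * u f z + R f z - c f) P ≤ ε := by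
  -- Counterexamples with δ = 1/(k+1) give an array: the index j selects d and R, the index k
  -- selects f. All its entries, not only the diagonal ones, lie in the class.
  by_contra! hcon
  choose d R c hd hd1 hR f hf hvar using fun k : ℕ => hcon (1 / ((k : ℝ) + 1)) (by positivity)
  have hδ : Tendsto (fun k : ℕ => ENNReal.ofReal (1 / ((k : ℝ) + 1))) atTop (𝓝 0) := by
    simpa using ENNReal.tendsto_ofReal tendsto_one_div_add_atTop_nhds_zero_nat
  have hδ1 : ∀ k : ℕ, ENNReal.ofReal (1 / ((k : ℝ) + 1)) ≤ 1 := by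
    intro k
    rw [ENNReal.ofReal_le_one, div_le_one (by positivity)]
    linarith [(Nat.cast_nonneg k : (0 : ℝ) ≤ k)]
  have hRint : ∀ j k, Integrable (R j (f k)) P := fun j k =>
    memLp_one_iff_integrable.1 ⟨(hR j _ (hf k)).1.aestronglyMeasurable,
      (hR j _ (hf k)).2.1.trans_lt ENNReal.ofReal_lt_top⟩
  have hmem : ∀ j k, (fun z => d j z * u (f k) z + R j (f k) z - c j (f k)) ∈ Φ :=
    fun j k => (hR j _ (hf k)).2.2.2.2
  let G : ℕ → ℕ → Lp ℝ 2 P := fun j k => ((hΦ _ (hmem j k)).sub (memLp_const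
    (∫ z, (d j z * u (f k) z + R j (f k) z - c j (f k)) ∂P))).toLp
  have hG : ∀ j k, G j k =ᵐ[P] fun z => (d j z * u (f k) z + R j (f k) z - c j (f k)) -
      ∫ z, (d j z * u (f k) z + R j (f k) z - c j (f k)) ∂P := fun j k => MemLp.coeFn_toLp _
  have hGT : ∀ j k, G j k ∈ centredClass P Φ := fun j k => ⟨_, hmem j k, hG j k⟩
  -- Centring removes the constant c and leaves the product untouched, since the product has mean
  -- zero.
  have hG' : ∀ j k, G j k =ᵐ[P]
      fun z => d j z * u (f k) z + (R j (f k) z - ∫ z, R j (f k) z ∂P) := by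
    intro j k
    have hi := (hR j _ (hf k)).2.2
    have : ∫ z, (d j z * u (f k) z + R j (f k) z - c j (f k)) ∂P =
        ∫ z, R j (f k) z ∂P - c j (f k) := by
      have hadd : Integrable (fun z => d j z * u (f k) z + R j (f k) z) P := hi.1.add (hRint j k)
      rw [integral_sub hadd (integrable_const _),
        integral_add hi.1 (hRint j k), hi.2.1]
      simp
    filter_upwards [hG j k] with z hz
    rw [hz, this]
    ring
  have hRc : ∀ j k, eLpNorm (fun z => R j (f k) z - ∫ z, R j (f k) z ∂P) 1 P ≤
      2 * ENNReal.ofReal (1 / ((j : ℝ) + 1)) := by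
    intro j k
    refine (eLpNorm_sub_le (hRint j k).1 aestronglyMeasurable_const le_rfl).trans ?_
    rw [two_mul]
    refine add_le_add (hR j _ (hf k)).2.1 (le_trans ?_ (hR j _ (hf k)).2.1)
    rw [eLpNorm_const _ (by simp) (IsProbabilityMeasure.ne_zero P)]
    simpa [eLpNorm_one_eq_lintegral_enorm] using enorm_integral_le_lintegral_enorm (R j (f k))
  -- The diagonal entries have an L² limit along a subsequence; it is also the L¹ limit of the
  -- products, as the R part vanishes in L¹.
  obtain ⟨H, -, σ, hσ, hlim⟩ := (hT.closure.isCompact_of_isClosed isClosed_closure).tendsto_subseq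
    fun k => subset_closure (hGT k k)
  obtain ⟨C, hC0, hC⟩ := hT.isBounded.exists_pos_norm_le
  have hL1 : Tendsto (fun k => eLpNorm ((fun z => d (σ k) z * u (f (σ k)) z) - ⇑H) 1 P)
      atTop (𝓝 0) := by
    have h2 : Tendsto (fun k => eLpNorm (⇑(G (σ k) (σ k)) - ⇑H : S → ℝ) 2 P +
        2 * ENNReal.ofReal (1 / (((σ k : ℕ) : ℝ) + 1))) atTop (𝓝 0) := by
      have h3 := (Lp.tendsto_Lp_iff_tendsto_eLpNorm' _ _).1 hlim
      simpa using h3.add (ENNReal.Tendsto.const_mul (a := 2) (hδ.comp hσ.tendsto_atTop)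
        (Or.inr (by simp)))
    refine tendsto_of_tendsto_of_tendsto_of_le_of_le tendsto_const_nhds h2 (fun _ => zero_le) ?_
    intro k
    have heq : ((fun z => d (σ k) z * u (f (σ k)) z) - ⇑H : S → ℝ) =ᵐ[P]
        (⇑(G (σ k) (σ k)) - ⇑H : S → ℝ) -
          (fun z => R (σ k) (f (σ k)) z - ∫ z, R (σ k) (f (σ k)) z ∂P) := by
      filter_upwards [hG' (σ k) (σ k)] with z hz
      simp only [Pi.sub_apply, hz]
      ring
    dsimp only
    rw [eLpNorm_congr_ae heq]
    have hm := ((Lp.aestronglyMeasurable (G (σ k) (σ k))).sub (Lp.aestronglyMeasurable H))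
    refine (eLpNorm_sub_le hm
      ((hRint _ _).1.sub aestronglyMeasurable_const) le_rfl).trans (add_le_add ?_ (hRc _ _))
    exact eLpNorm_le_eLpNorm_of_exponent_le (by norm_num) hm
  have hdint : ∀ k, MemLp (d k) 1 P := fun k =>
    ⟨(hd k).aestronglyMeasurable, (hd1 k).trans_lt ENNReal.ofReal_lt_top⟩
  obtain ⟨τ, hτ, hτlim⟩ := (tendstoInMeasure_of_tendsto_eLpNorm one_ne_zero
    (fun k => (hR _ _ (hf _)).2.2.1.1) (Lp.aestronglyMeasurable H) hL1).exists_seq_tendsto_ae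
  have hd0 : Tendsto (fun k => eLpNorm (d (σ (τ k)) - fun _ => 0) 1 P) atTop (𝓝 0) := by
    refine tendsto_of_tendsto_of_tendsto_of_le_of_le tendsto_const_nhds
      (hδ.comp (hσ.comp hτ).tendsto_atTop) (fun _ => zero_le) fun k => ?_
    have : (d (σ (τ k)) - fun _ => 0) = d (σ (τ k)) := by ext z; simp
    rw [this]
    exact hd1 _
  obtain ⟨υ, hυ, hυlim⟩ := (tendstoInMeasure_of_tendsto_eLpNorm one_ne_zero
    (fun k => (hdint _).1) aestronglyMeasurable_const hd0).exists_seq_tendsto_ae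
  set s : ℕ → ℕ := fun k => σ (τ (υ k)) with hs
  -- Fatou's lemma along a row of the array: the L¹ norm is at most C from the totally bounded class
  -- plus 2 from the centred R.
  have hbdd : ∀ j, ∀ᵐ z ∂P, liminf (fun k => ‖d j z * u (f (s k)) z‖ₑ) atTop < ∞ := by
    intro j
    refine ae_bdd_liminf_atTop_of_eLpNorm_bdd (p := 1) (R := C.toNNReal + 2) one_ne_zero
      (fun k => (hd j).mul (hu _ (hf _))) fun k => ?_
    have heq : (fun z => d j z * u (f (s k)) z) =ᵐ[P] (⇑(G j (s k)) : S → ℝ) -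
          (fun z => R j (f (s k)) z - ∫ z, R j (f (s k)) z ∂P) := by
      filter_upwards [hG' j (s k)] with z hz
      simp only [Pi.sub_apply, hz]
      ring
    rw [eLpNorm_congr_ae heq]
    push_cast
    refine (eLpNorm_sub_le (Lp.aestronglyMeasurable _)
      ((hRint _ _).1.sub aestronglyMeasurable_const) le_rfl).trans (add_le_add ?_ ?_)
    · refine (eLpNorm_le_eLpNorm_of_exponent_le (q := 2) (by norm_num)
        (Lp.aestronglyMeasurable _)).trans ?_
      rw [← Lp.enorm_def, ← ofReal_norm]
      exact ENNReal.ofReal_le_ofReal (hC _ (hGT _ _))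
    · refine (hRc _ _).trans ?_
      calc 2 * ENNReal.ofReal (1 / ((j : ℝ) + 1)) ≤ 2 * 1 := by gcongr; exact hδ1 j
        _ = 2 := by simp
  have hH : H = 0 := by
    refine Lp.ext ?_
    filter_upwards [hτlim, hυlim, ae_all_iff.2 hbdd, Lp.coeFn_zero ℝ 2 P] with z h1 h2 h3 h4
    rw [h4]
    exact eq_zero_of_tendsto_mul (d := fun k => d (s k) z) (u := fun k => u (f (s k)) z) h2
      (h1.comp hυ.tendsto_atTop) fun j => h3 (s j)
  -- These squared norms are the variances, which were assumed to exceed ε.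
  have hnorm : Tendsto (fun k => ‖G (σ k) (σ k)‖ ^ 2) atTop (𝓝 0) := by
    rw [hH] at hlim
    simpa using hlim.norm.pow 2
  obtain ⟨k, hk⟩ := (hnorm.eventually (gt_mem_nhds hε)).exists
  rw [norm_sq_eq_variance (hΦ _ (hmem _ _)).1.aemeasurable (hG _ _)] at hk
  exact (hvar (σ k)).not_gt hk

end Variance

/-! ### Conditional means given the covariate -/

section CondMean

variable {α β : Type*} [MeasurableSpace α] [MeasurableSpace β] [StandardBorelSpace β] [Nonempty β]
  {P : Measure (α × β)} [IsFiniteMeasure P] {u : α × β → ℝ}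

theorem measurable_integral_condKernel (hu : Measurable u) :
    Measurable fun w => ∫ q, u (w, q) ∂(P.condKernel w) :=
  hu.stronglyMeasurable.integral_kernel_prod_right'.measurable

/-- Jensen's inequality in each fibre, integrated over the first coordinate. -/
theorem memLp_integral_condKernel (hu : Measurable u) (hu2 : MemLp u 2 P) :
    MemLp (fun z : α × β => ∫ q, u (z.1, q) ∂(P.condKernel z.1)) 2 P := by
  have hm : Measurable fun z : α × β => ∫ q, u (z.1, q) ∂(P.condKernel z.1) :=
    (measurable_integral_condKernel hu).comp measurable_fst
  refine ⟨hm.aestronglyMeasurable, ?_⟩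
  rw [eLpNorm_lt_top_iff_lintegral_rpow_enorm_lt_top (by simp) (by simp)]
  have h2 := (eLpNorm_lt_top_iff_lintegral_rpow_enorm_lt_top (by simp) (by simp)).1 hu2.2
  refine lt_of_le_of_lt ?_ h2
  simp only [ENNReal.toReal_ofNat]
  rw [← Measure.lintegral_condKernel (hm.enorm.pow_const _),
    ← Measure.lintegral_condKernel (hu.enorm.pow_const _)]
  refine lintegral_mono fun w => ?_
  simp only [lintegral_const, measure_univ, mul_one]
  calc ‖∫ q, u (w, q) ∂(P.condKernel w)‖ₑ ^ (2 : ℝ)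
      ≤ (eLpNorm (fun q => u (w, q)) 2 (P.condKernel w)) ^ (2 : ℝ) := by
        gcongr
        refine (enorm_integral_le_lintegral_enorm _).trans ?_
        rw [← eLpNorm_one_eq_lintegral_enorm]
        exact eLpNorm_le_eLpNorm_of_exponent_le (by norm_num)
          (hu.comp measurable_prodMk_left).aestronglyMeasurable
    _ = ∫⁻ q, ‖u (w, q)‖ₑ ^ (2 : ℝ) ∂(P.condKernel w) := by
        rw [eLpNorm_eq_lintegral_rpow_enorm_toReal (by simp) (by simp)]
        simp only [ENNReal.toReal_ofNat]
        rw [← ENNReal.rpow_mul]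
        simp

/-- The residual of a square-integrable function after subtracting its conditional mean given the
first coordinate is orthogonal to functions of the first coordinate. -/
theorem integral_mul_sub_integral_condKernel (hu : Measurable u) (hu2 : MemLp u 2 P) {v : α → ℝ}
    (hv2 : MemLp (fun z : α × β => v z.1) 2 P) :
    ∫ z, v z.1 * (u z - ∫ q, u (z.1, q) ∂(P.condKernel z.1)) ∂P = 0 := by
  have hM := memLp_integral_condKernel hu hu2
  have h1 : Integrable (fun z : α × β => v z.1 * u z) P := hv2.integrable_mul hu2
  have h2 : Integrable (fun z : α × β => v z.1 * ∫ q, u (z.1, q) ∂(P.condKernel z.1)) P :=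
    hv2.integrable_mul hM
  simp only [mul_sub]
  rw [integral_sub h1 h2, ← Measure.integral_condKernel h1, ← Measure.integral_condKernel h2]
  simp [integral_const_mul]

end CondMean

/-! ### Quadratic functions and empirical means -/

theorem hasDerivAt_quadratic {F : ℝ → ℝ} {a b c : ℝ} (h : ∀ β, F β = a + b * β + c * β ^ 2)
    (β : ℝ) : HasDerivAt F (b + 2 * c * β) β := by
  obtain rfl : F = fun β => a + b * β + c * β ^ 2 := funext h
  have := (((hasDerivAt_id β).const_mul b).const_add a).add (((hasDerivAt_id β).pow 2).const_mul c)
  convert! this using 1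
  simp; ring

theorem deriv_quadratic {F : ℝ → ℝ} {a b c : ℝ} (h : ∀ β, F β = a + b * β + c * β ^ 2) :
    deriv F = fun β => b + 2 * c * β :=
  funext fun β => (hasDerivAt_quadratic h β).deriv

theorem differentiableAt_deriv_quadratic {F : ℝ → ℝ} {a b c : ℝ}
    (h : ∀ β, F β = a + b * β + c * β ^ 2) (β : ℝ) : DifferentiableAt ℝ (deriv F) β := by
  rw [deriv_quadratic h]
  fun_prop

section EmpMean

variable {S : Type*} {n : ℕ} (z : Fin n → S)

theorem empMean_add (g h : S → ℝ) :
    empMean z (fun s => g s + h s) = empMean z g + empMean z h := by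
  simp [empMean, Finset.sum_add_distrib, mul_add]

theorem empMean_sub (g h : S → ℝ) :
    empMean z (fun s => g s - h s) = empMean z g - empMean z h := by
  simp [empMean, Finset.sum_sub_distrib, mul_sub]

theorem empMean_mul_right (g : S → ℝ) (c : ℝ) :
    empMean z (fun s => g s * c) = empMean z g * c := by
  simp [empMean, ← Finset.sum_mul, mul_assoc]

theorem empMean_const (hn : n ≠ 0) (c : ℝ) : empMean z (fun _ => c) = c := by
  have : (n : ℝ) ≠ 0 := by exact_mod_cast hn
  simp [empMean, this]

end EmpMean

theorem rpow_neg_half_eq (n : ℕ) : (n : ℝ) ^ (-(1 / 2) : ℝ) = (√n)⁻¹ := by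
  rw [Real.rpow_neg (Nat.cast_nonneg n), Real.sqrt_eq_rpow]

/-! ### Rates for empirical means and norms of products -/

section Rates

variable {S Ω D : Type*} [MeasurableSpace S] {P : Measure S} {Φ : Set (S → ℝ)}

/-- Empirical means of random functions that, up to constants, lie in a Donsker class and have
vanishing variances, are `o_P(n^{-1/2})` if the means of these functions are. -/
theorem IsDonsker.withProbTendingToOne_empMean_le [MeasurableSpace Ω] {μ : Measure Ω}
    [IsProbabilityMeasure μ] [IsProbabilityMeasure P] {Z : ℕ → Ω → S} (hZ : ∀ i, Measurable (Z i))
    (hindep : iIndepFun Z μ) (hlaw : ∀ i, μ.map (Z i) = P) (h : IsDonsker P Φ) {𝔉 : Set D}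
    {F : ℕ → Ω → D → S → ℝ} {c : ℕ → Ω → D → ℝ}
    (hmem : WithProbTendingToOne μ fun n ω => ∀ f ∈ 𝔉, (fun z => F n ω f z - c n ω f) ∈ Φ)
    (hvar : ∀ ρ : ℝ, 0 < ρ → WithProbTendingToOne μ fun n ω => ∀ f ∈ 𝔉,
      variance (fun z => F n ω f z - c n ω f) P ≤ ρ)
    (hmean : ∀ ε : ℝ, 0 < ε → WithProbTendingToOne μ fun n ω => ∀ f ∈ 𝔉,
      |∫ z, F n ω f z ∂P| ≤ ε * (n : ℝ) ^ (-(1 / 2) : ℝ)) {ε : ℝ} (hε : 0 < ε) :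
    WithProbTendingToOne μ fun n ω => ∀ f ∈ 𝔉,
      |empMean (sample Z n ω) (F n ω f)| ≤ ε * (n : ℝ) ^ (-(1 / 2) : ℝ) := by
  have hε2 : 0 < ε / 2 := half_pos hε
  have hemp := h.withProbTendingToOne_abs_le hZ hindep hlaw
    (A := fun n ω => (fun f => fun z => F n ω f z - c n ω f) '' 𝔉) (fun ρ hρ =>
      (hmem.and (hvar ρ hρ)).mono <| Eventually.of_forall <| by
        rintro n ω ⟨h1, h2⟩ _ ⟨f, hf, rfl⟩
        exact ⟨h1 f hf, h2 f hf⟩) hε2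
  refine ((hmem.and hemp).and (hmean _ hε2)).mono ?_
  filter_upwards [eventually_ne_atTop 0] with n hn
  rintro ω ⟨⟨h1, h2⟩, h3⟩ f hf
  have hint : Integrable (F n ω f) P := by
    have := ((h.1 _ (h1 f hf)).2.integrable (by norm_num)).add (integrable_const (c n ω f))
    exact this.congr (Eventually.of_forall fun z => by simp)
  have h4 := h2 _ ⟨f, hf, rfl⟩
  dsimp only at h4
  -- For n ≠ 0 the empirical measure and P both have mass one, so the unknown constant cancels.
  rw [empMean_sub, empMean_const _ hn, integral_sub hint (integrable_const _), integral_const,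
    probReal_univ, one_smul, sub_sub_sub_cancel_right, abs_mul, abs_of_nonneg (Real.sqrt_nonneg _)]
    at h4
  have h5 := h3 f hf
  have hsq : 0 < √(n : ℝ) := Real.sqrt_pos.2 (by positivity)
  rw [rpow_neg_half_eq] at h5 ⊢
  have h6 : |empMean (sample Z n ω) (F n ω f) - ∫ z, F n ω f z ∂P| ≤ ε / 2 * (√n)⁻¹ := by
    rw [← div_eq_mul_inv, le_div_iff₀ hsq, mul_comm]
    exact h4
  calc |empMean (sample Z n ω) (F n ω f)|
      = |(empMean (sample Z n ω) (F n ω f) - ∫ z, F n ω f z ∂P) + ∫ z, F n ω f z ∂P| := by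
        rw [sub_add_cancel]
    _ ≤ ε / 2 * (√n)⁻¹ + ε / 2 * (√n)⁻¹ := (abs_add_le _ _).trans (add_le_add h6 h5)
    _ = ε * (√n)⁻¹ := by ring

theorem abs_integral_sq_le {d : S → ℝ} {a : ℝ} (ha : 0 ≤ a)
    (h : eLpNorm d 2 P ≤ ENNReal.ofReal a) : |∫ z, d z ^ 2 ∂P| ≤ a ^ 2 := by
  rw [← ENNReal.ofReal_le_ofReal_iff (by positivity), ← Real.enorm_eq_ofReal_abs]
  calc ‖∫ z, d z ^ 2 ∂P‖ₑ ≤ ∫⁻ z, ‖d z ^ 2‖ₑ ∂P := enorm_integral_le_lintegral_enorm _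
    _ = eLpNorm d 2 P ^ 2 := by
      rw [eLpNorm_eq_lintegral_rpow_enorm_toReal (by simp) (by simp), ← ENNReal.rpow_natCast,
        ← ENNReal.rpow_mul]
      simp
    _ ≤ ENNReal.ofReal a ^ 2 := by gcongr
    _ = ENNReal.ofReal (a ^ 2) := (ENNReal.ofReal_pow ha 2).symm

/-- Hölder's inequality. As e is merely square-integrable, this gives smallness in L¹ and not in L²;
`exists_variance_le` asks for no more. -/
theorem exists_eLpNorm_two_mul_le {e : S → ℝ} (he : MemLp e 2 P) {δ : ℝ} (hδ : 0 < δ) :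
    ∃ δ' : ℝ, 0 < δ' ∧ ∀ a γ : S → ℝ, Measurable a → Measurable γ →
      eLpNorm a 2 P ≤ ENNReal.ofReal δ' → eLpNorm γ 2 P ≤ ENNReal.ofReal δ' →
      eLpNorm (fun z => (e z + a z) * (2 * γ z)) 1 P ≤ ENNReal.ofReal δ := by
  obtain ⟨M, hM0, hM⟩ : ∃ M : ℝ, 0 ≤ M ∧ eLpNorm e 2 P = ENNReal.ofReal M :=
    ⟨_, ENNReal.toReal_nonneg, (ENNReal.ofReal_toReal he.2.ne).symm⟩
  have h0 : 0 < δ / (2 * (M + 1)) := by positivity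
  refine ⟨min 1 (δ / (2 * (M + 1))), lt_min one_pos h0, fun a γ ha hγ ha1 hγ1 => ?_⟩
  have h1 : eLpNorm (fun z => 2 * γ z) 2 P ≤ ENNReal.ofReal (2 * (δ / (2 * (M + 1)))) := by
    have : (fun z => 2 * γ z) = (2 : ℝ) • γ := by ext z; simp
    rw [this, eLpNorm_const_smul, ENNReal.ofReal_mul (by norm_num)]
    refine mul_le_mul' (by simp [Real.enorm_eq_ofReal_abs]) (hγ1.trans ?_)
    exact ENNReal.ofReal_le_ofReal (min_le_right _ _)
  have h2 : eLpNorm (fun z => e z + a z) 2 P ≤ ENNReal.ofReal (M + 1) := by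
    refine (eLpNorm_add_le he.1 ha.aestronglyMeasurable (by norm_num)).trans ?_
    rw [ENNReal.ofReal_add hM0 one_pos.le, hM]
    gcongr
    exact ha1.trans (ENNReal.ofReal_le_ofReal (min_le_left _ _))
  have h3 : eLpNorm ((fun z => e z + a z) • fun z => 2 * γ z) 1 P ≤
      eLpNorm (fun z => e z + a z) 2 P * eLpNorm (fun z => 2 * γ z) 2 P :=
    eLpNorm_smul_le_mul_eLpNorm (hγ.const_mul 2).aestronglyMeasurable
      (he.1.add ha.aestronglyMeasurable)
  refine h3.trans ((mul_le_mul' h2 h1).trans ?_)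
  rw [← ENNReal.ofReal_mul (by positivity)]
  refine ENNReal.ofReal_le_ofReal (le_of_eq ?_)
  field_simp

end Rates

/-! ### The remainder of the one-step estimator -/

section Regression

variable {d₁ d₂ : ℕ} (P : Measure (Obs d₁ d₂)) [IsProbabilityMeasure P]

/-- The difference `{y - m(w)}² - {y - μ_{P,Y}(w)}²`, in terms of `μ_{P,Y} - m` and
`y - μ_{P,Y}`. -/
def baseDiff (m : Cov d₂ → ℝ) (z : Obs d₁ d₂) : ℝ :=
  ((z.2.2 - condMeanY P z.1) + 2⁻¹ * (condMeanY P z.1 - m z.1)) *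
    (2 * (condMeanY P z.1 - m z.1))

/-- The difference of the slopes in `β`, at `β = 0`, of `{y - m - β f}² + 2 β (y - m) m_f` for the
estimated and for the true conditional means. -/
def slopeDiff (m mf : Cov d₂ → ℝ) (f : Dir d₁ d₂) (z : Obs d₁ d₂) : ℝ :=
  (condMeanY P z.1 - m z.1) * (-2 * (f (z.1, z.2.1) - condMeanDir P f z.1)) +
    ((z.2.2 - condMeanY P z.1) + (condMeanY P z.1 - m z.1)) *
      (2 * (mf z.1 - condMeanDir P f z.1))

theorem influence_eq (m mf : Cov d₂ → ℝ) (G : ℝ → ℝ) (f : Dir d₁ d₂) (z : Obs d₁ d₂) (β : ℝ) :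
    influence m mf G f z β = (z.2.2 - m z.1) ^ 2 +
      (2 * (z.2.2 - m z.1) * (mf z.1 - f (z.1, z.2.1))) * β + f (z.1, z.2.1) ^ 2 * β ^ 2 - G β := by
  simp only [influence, sqLoss]
  ring

theorem deriv_influence_zero (m mf : Cov d₂ → ℝ) {G : ℝ → ℝ} {a b c : ℝ}
    (hG : ∀ β, G β = a + b * β + c * β ^ 2) (f : Dir d₁ d₂) (z : Obs d₁ d₂) :
    deriv (influence m mf G f z) 0 = 2 * (z.2.2 - m z.1) * (mf z.1 - f (z.1, z.2.1)) - b := by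
  have h : ∀ β, influence m mf G f z β = ((z.2.2 - m z.1) ^ 2 - a) +
      (2 * (z.2.2 - m z.1) * (mf z.1 - f (z.1, z.2.1)) - b) * β +
      (f (z.1, z.2.1) ^ 2 - c) * β ^ 2 := by
    intro β
    rw [influence_eq, hG]
    ring
  rw [deriv_quadratic h]
  simp

theorem measurable_condMeanY : Measurable (condMeanY P) :=
  measurable_integral_condKernel (P := P) (u := fun z : Obs d₁ d₂ => z.2.2) (by fun_prop)

theorem Dir.measurable_obs {f : Dir d₁ d₂} (hf : Measurable f) :
    Measurable fun z : Obs d₁ d₂ => f (z.1, z.2.1) :=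
  hf.comp (measurable_fst.prodMk (measurable_fst.comp measurable_snd))

theorem measurable_condMeanDir {f : Dir d₁ d₂} (hf : Measurable f) :
    Measurable (condMeanDir P f) :=
  measurable_integral_condKernel (P := P) (u := fun z : Obs d₁ d₂ => f (z.1, z.2.1))
    (Dir.measurable_obs hf)

variable {P}

theorem memLp_condMeanY (hY : MemLp (fun z : Obs d₁ d₂ => z.2.2) 2 P) :
    MemLp (fun z : Obs d₁ d₂ => condMeanY P z.1) 2 P :=
  memLp_integral_condKernel (u := fun z : Obs d₁ d₂ => z.2.2) (by fun_prop) hY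

theorem memLp_condMeanDir {f : Dir d₁ d₂} (hf : Measurable f)
    (hf2 : MemLp (fun z : Obs d₁ d₂ => f (z.1, z.2.1)) 2 P) :
    MemLp (fun z : Obs d₁ d₂ => condMeanDir P f z.1) 2 P :=
  memLp_integral_condKernel (u := fun z : Obs d₁ d₂ => f (z.1, z.2.1))
    (Dir.measurable_obs hf) hf2

theorem integral_mul_sub_condMeanY (hY : MemLp (fun z : Obs d₁ d₂ => z.2.2) 2 P) {v : Cov d₂ → ℝ}
    (hv : MemLp (fun z : Obs d₁ d₂ => v z.1) 2 P) :
    ∫ z, v z.1 * (z.2.2 - condMeanY P z.1) ∂P = 0 :=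
  integral_mul_sub_integral_condKernel (u := fun z : Obs d₁ d₂ => z.2.2) (by fun_prop) hY hv

theorem integral_mul_sub_condMeanDir {f : Dir d₁ d₂} (hf : Measurable f)
    (hf2 : MemLp (fun z : Obs d₁ d₂ => f (z.1, z.2.1)) 2 P) {v : Cov d₂ → ℝ}
    (hv : MemLp (fun z : Obs d₁ d₂ => v z.1) 2 P) :
    ∫ z, v z.1 * (f (z.1, z.2.1) - condMeanDir P f z.1) ∂P = 0 :=
  integral_mul_sub_integral_condKernel (u := fun z : Obs d₁ d₂ => f (z.1, z.2.1))
    (Dir.measurable_obs hf) hf2 hv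

theorem goodnessOfFit_eq (hY : MemLp (fun z : Obs d₁ d₂ => z.2.2) 2 P) {f : Dir d₁ d₂}
    (hf2 : MemLp (fun z : Obs d₁ d₂ => f (z.1, z.2.1)) 2 P) :
    ∃ a b c : ℝ, ∀ β, goodnessOfFit P f β = a + b * β + c * β ^ 2 := by
  have he := hY.sub (memLp_condMeanY hY)
  refine ⟨∫ z, (z.2.2 - condMeanY P z.1) ^ 2 ∂P,
    ∫ z, -2 * ((z.2.2 - condMeanY P z.1) * f (z.1, z.2.1)) ∂P,
    ∫ z, f (z.1, z.2.1) ^ 2 ∂P, fun β => ?_⟩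
  have h1 : Integrable (fun z : Obs d₁ d₂ => (z.2.2 - condMeanY P z.1) ^ 2) P := he.integrable_sq
  have h2 : Integrable (fun z : Obs d₁ d₂ =>
      -2 * ((z.2.2 - condMeanY P z.1) * f (z.1, z.2.1)) * β) P :=
    ((he.integrable_mul hf2).const_mul (-2)).mul_const β
  have h3 : Integrable (fun z : Obs d₁ d₂ => f (z.1, z.2.1) ^ 2 * β ^ 2) P :=
    hf2.integrable_sq.mul_const _
  have h12 : Integrable (fun z : Obs d₁ d₂ => (z.2.2 - condMeanY P z.1) ^ 2 +
      -2 * ((z.2.2 - condMeanY P z.1) * f (z.1, z.2.1)) * β) P := h1.add h2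
  rw [← integral_mul_const, ← integral_mul_const, ← integral_add h1 h2, ← integral_add h12 h3]
  refine integral_congr_ae (Eventually.of_forall fun z => ?_)
  simp only [sqLoss]
  ring

/-- The cross term pairs the residual of Y with a function of w and integrates to zero. -/
theorem integral_baseDiff (hY : MemLp (fun z : Obs d₁ d₂ => z.2.2) 2 P) {m : Cov d₂ → ℝ}
    (hm : MemLp (fun z : Obs d₁ d₂ => condMeanY P z.1 - m z.1) 2 P) :
    ∫ z, baseDiff P m z ∂P = ∫ z : Obs d₁ d₂, (condMeanY P z.1 - m z.1) ^ 2 ∂P := by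
  have he := hY.sub (memLp_condMeanY hY)
  have h1 : Integrable (fun z : Obs d₁ d₂ => (condMeanY P z.1 - m z.1) ^ 2) P := hm.integrable_sq
  have h2 : Integrable (fun z : Obs d₁ d₂ =>
      2 * ((condMeanY P z.1 - m z.1) * (z.2.2 - condMeanY P z.1))) P :=
    (hm.integrable_mul he).const_mul 2
  have h := integral_mul_sub_condMeanY hY (v := fun w => condMeanY P w - m w) hm
  calc ∫ z, baseDiff P m z ∂P = ∫ z : Obs d₁ d₂, ((condMeanY P z.1 - m z.1) ^ 2 +
        2 * ((condMeanY P z.1 - m z.1) * (z.2.2 - condMeanY P z.1))) ∂P := by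
        refine integral_congr_ae (Eventually.of_forall fun z => ?_)
        simp only [baseDiff]
        ring
    _ = _ := by rw [integral_add h1 h2, integral_const_mul, h, mul_zero, add_zero]

/-- Both first-order terms vanish by orthogonality, of the residual of f and of that of Y; only the
product of the two nuisance errors survives. -/
theorem integral_slopeDiff (hY : MemLp (fun z : Obs d₁ d₂ => z.2.2) 2 P) {m mf : Cov d₂ → ℝ}
    (hm : MemLp (fun z : Obs d₁ d₂ => condMeanY P z.1 - m z.1) 2 P) {f : Dir d₁ d₂}
    (hf : Measurable f) (hf2 : MemLp (fun z : Obs d₁ d₂ => f (z.1, z.2.1)) 2 P)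
    (hmf : MemLp (fun z : Obs d₁ d₂ => condMeanDir P f z.1 - mf z.1) 2 P) :
    ∫ z, slopeDiff P m mf f z ∂P = -2 * ∫ z : Obs d₁ d₂,
      (condMeanDir P f z.1 - mf z.1) * (condMeanY P z.1 - m z.1) ∂P := by
  have he := hY.sub (memLp_condMeanY hY)
  have hu := hf2.sub (memLp_condMeanDir hf hf2)
  have h1 : Integrable (fun z : Obs d₁ d₂ =>
      (condMeanY P z.1 - m z.1) * (f (z.1, z.2.1) - condMeanDir P f z.1)) P := hm.integrable_mul hu
  have h2 : Integrable (fun z : Obs d₁ d₂ =>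
      (condMeanDir P f z.1 - mf z.1) * (z.2.2 - condMeanY P z.1)) P := hmf.integrable_mul he
  have h3 : Integrable (fun z : Obs d₁ d₂ =>
      (condMeanDir P f z.1 - mf z.1) * (condMeanY P z.1 - m z.1)) P := hmf.integrable_mul hm
  have h12 := h1.add h2
  have e1 := integral_mul_sub_condMeanDir hf hf2 (v := fun w => condMeanY P w - m w) hm
  have e2 := integral_mul_sub_condMeanY hY (v := fun w => condMeanDir P f w - mf w) hmf
  have e12 := integral_add h1 h2
  have e123 := integral_add h12 h3
  simp only [Pi.add_apply] at e123
  rw [e12, e1, e2, zero_add, zero_add] at e123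
  rw [← e123, ← integral_const_mul]
  refine integral_congr_ae (Eventually.of_forall fun z => ?_)
  simp only [slopeDiff]
  ring

/-! ### Expansion of the one-step estimator and its remainder in β -/

section Estimators

variable {Ω : Type*} (Z : ℕ → Ω → Obs d₁ d₂) (mY : ℕ → Ω → Cov d₂ → ℝ)
  (mF : ℕ → Ω → Dir d₁ d₂ → Cov d₂ → ℝ)

theorem plugIn_eq (n : ℕ) (ω : Ω) (f : Dir d₁ d₂) :
    ∃ a b c : ℝ, ∀ β, plugIn Z mY n ω f β = a + b * β + c * β ^ 2 := by
  refine ⟨empMean (sample Z n ω) (fun z => (z.2.2 - mY n ω z.1) ^ 2),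
    empMean (sample Z n ω) (fun z => -2 * (z.2.2 - mY n ω z.1) * f (z.1, z.2.1)),
    empMean (sample Z n ω) (fun z => f (z.1, z.2.1) ^ 2), fun β => ?_⟩
  rw [← empMean_mul_right, ← empMean_mul_right, ← empMean_add, ← empMean_add, plugIn]
  congr 1
  ext z
  simp only [sqLoss]
  ring

theorem oneStep_eq (n : ℕ) (ω : Ω) (f : Dir d₁ d₂) (β : ℝ) :
    oneStep Z mY mF n ω f β = empMean (sample Z n ω) (fun z => (z.2.2 - mY n ω z.1) ^ 2) +
      empMean (sample Z n ω)
        (fun z => 2 * (z.2.2 - mY n ω z.1) * (mF n ω f z.1 - f (z.1, z.2.1))) * β +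
      empMean (sample Z n ω) (fun z => f (z.1, z.2.1) ^ 2) * β ^ 2 := by
  rw [← empMean_mul_right, ← empMean_mul_right, ← empMean_add, ← empMean_add, oneStep]
  simp only [estInfluence, influence_eq, empMean_sub]
  rcases eq_or_ne n 0 with rfl | hn
  · simp [plugIn, empMean]
  · rw [empMean_const _ hn]
    ring

theorem empMean_effInfluence_eq (n : ℕ) (ω : Ω) (f : Dir d₁ d₂) (β : ℝ) :
    empMean (sample Z n ω) (fun z => effInfluence P f z β) =
      empMean (sample Z n ω) (fun z => (z.2.2 - condMeanY P z.1) ^ 2) +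
      empMean (sample Z n ω)
        (fun z => 2 * (z.2.2 - condMeanY P z.1) * (condMeanDir P f z.1 - f (z.1, z.2.1))) * β +
      empMean (sample Z n ω) (fun z => f (z.1, z.2.1) ^ 2) * β ^ 2 -
      empMean (sample Z n ω) (fun _ => 1) * goodnessOfFit P f β := by
  have h := empMean_mul_right (sample Z n ω) (fun _ => 1) (goodnessOfFit P f β)
  simp only [one_mul] at h
  simp only [effInfluence, influence_eq, empMean_sub, empMean_add, empMean_mul_right, h]

/-- The terms in f² β² and the goodness-of-fit cancel. The vanishing quadratic term is kept so that
the lemmas on quadratic functions apply. -/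
theorem remainder_eq {n : ℕ} (hn : n ≠ 0) (ω : Ω) (f : Dir d₁ d₂) (β : ℝ) :
    remainder Z (oneStep Z mY mF) (goodnessOfFit P) (effInfluence P) n ω f β =
      empMean (sample Z n ω) (baseDiff P (mY n ω)) +
      empMean (sample Z n ω) (slopeDiff P (mY n ω) (mF n ω f) f) * β + 0 * β ^ 2 := by
  have h1 : baseDiff P (mY n ω) = fun z =>
      (z.2.2 - mY n ω z.1) ^ 2 - (z.2.2 - condMeanY P z.1) ^ 2 := by
    ext z; simp only [baseDiff]; ring
  have h2 : slopeDiff P (mY n ω) (mF n ω f) f = fun z =>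
      2 * (z.2.2 - mY n ω z.1) * (mF n ω f z.1 - f (z.1, z.2.1)) -
      2 * (z.2.2 - condMeanY P z.1) * (condMeanDir P f z.1 - f (z.1, z.2.1)) := by
    ext z; simp only [slopeDiff]; ring
  rw [remainder, oneStep_eq, empMean_effInfluence_eq, empMean_const _ hn, h1, h2, empMean_sub,
    empMean_sub]
  ring

theorem exists_remainder_eq (hY : MemLp (fun z : Obs d₁ d₂ => z.2.2) 2 P) {f : Dir d₁ d₂}
    (hf2 : MemLp (fun z : Obs d₁ d₂ => f (z.1, z.2.1)) 2 P) (n : ℕ) (ω : Ω) :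
    ∃ a b c : ℝ, ∀ β, remainder Z (oneStep Z mY mF) (goodnessOfFit P) (effInfluence P) n ω f β =
      a + b * β + c * β ^ 2 := by
  -- Differentiability is claimed for every n. For n = 0 empirical means are zero, and the remainder
  -- is minus the goodness-of-fit.
  rcases eq_or_ne n 0 with rfl | hn
  · obtain ⟨a, b, c, h⟩ := goodnessOfFit_eq hY hf2
    refine ⟨-a, -b, -c, fun β => ?_⟩
    simp only [remainder, oneStep, plugIn, empMean, h, Finset.univ_eq_empty, Finset.sum_empty]
    ring
  · exact ⟨_, _, _, remainder_eq Z mY mF hn ω f⟩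

theorem estInfluence_sub_effInfluence_zero (n : ℕ) (ω : Ω) (f : Dir d₁ d₂) :
    (fun z => estInfluence Z mY mF n ω f z 0 - effInfluence P f z 0) =
      fun z => baseDiff P (mY n ω) z - (plugIn Z mY n ω f 0 - goodnessOfFit P f 0) := by
  ext z
  simp only [estInfluence, effInfluence, influence_eq, baseDiff]
  ring

theorem deriv_estInfluence_sub_effInfluence_zero
    (hY : MemLp (fun z : Obs d₁ d₂ => z.2.2) 2 P) {f : Dir d₁ d₂}
    (hf2 : MemLp (fun z : Obs d₁ d₂ => f (z.1, z.2.1)) 2 P) (n : ℕ) (ω : Ω) :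
    (fun z => deriv (estInfluence Z mY mF n ω f z) 0 - deriv (effInfluence P f z) 0) =
      fun z => slopeDiff P (mY n ω) (mF n ω f) f z -
        (deriv (plugIn Z mY n ω f) 0 - deriv (goodnessOfFit P f) 0) := by
  obtain ⟨a, b, c, h⟩ := goodnessOfFit_eq hY hf2
  obtain ⟨a', b', c', h'⟩ := plugIn_eq Z mY n ω f
  ext z
  have e1 : deriv (estInfluence Z mY mF n ω f z) 0 = _ :=
    deriv_influence_zero (mY n ω) (mF n ω f) h' f z
  have e2 : deriv (effInfluence P f z) 0 = _ :=
    deriv_influence_zero (condMeanY P) (condMeanDir P f) h f z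
  rw [e1, e2, deriv_quadratic h, deriv_quadratic h', slopeDiff]
  ring

end Estimators

/-- If `baseDiff P m` lies, up to constants, in a class that is totally bounded modulo constants,
its variance is small when `m` is close to the conditional mean. -/
theorem exists_variance_baseDiff_le (hY : MemLp (fun z : Obs d₁ d₂ => z.2.2) 2 P)
    {Φ : Set (Obs d₁ d₂ → ℝ)} (hΦ : IsDonsker P Φ) {ε : ℝ} (hε : 0 < ε) :
    ∃ δ : ℝ, 0 < δ ∧ ∀ (m : Cov d₂ → ℝ) (c : ℝ), Measurable m →
      eLpNorm (fun z : Obs d₁ d₂ => condMeanY P z.1 - m z.1) 2 P ≤ ENNReal.ofReal δ →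
      (fun z => baseDiff P m z - c) ∈ Φ → variance (fun z => baseDiff P m z - c) P ≤ ε := by
  -- No direction is involved, so the product part is taken to be zero and `baseDiff` is entirely
  -- the part small in L¹.
  obtain ⟨δ, hδ, h⟩ := exists_variance_le (fun φ hφ => (hΦ.1 φ hφ).2) hΦ.totallyBounded
    (Set.univ : Set Unit) (fun _ _ => 0) (fun _ _ => measurable_const) hε
  have he := hY.sub (memLp_condMeanY hY)
  obtain ⟨δ', hδ', h'⟩ := exists_eLpNorm_two_mul_le he hδ
  refine ⟨δ', hδ', fun m c hm hm2 hmem => ?_⟩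
  have hdm : Measurable fun z : Obs d₁ d₂ => condMeanY P z.1 - m z.1 :=
    ((measurable_condMeanY P).comp measurable_fst).sub (hm.comp measurable_fst)
  have hY0 := measurable_condMeanY P
  have hbm : Measurable (baseDiff P m) := by
    unfold baseDiff
    fun_prop
  have hhalf : eLpNorm (fun z : Obs d₁ d₂ => 2⁻¹ * (condMeanY P z.1 - m z.1)) 2 P ≤
      ENNReal.ofReal δ' := by
    refine le_trans (eLpNorm_mono fun z => ?_) hm2
    rw [norm_mul]
    refine mul_le_of_le_one_left (norm_nonneg _) (by norm_num)
  have := h (fun _ => 0) (fun _ => baseDiff P m) (fun _ => c) measurable_const (by simp)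
    (fun f _ => ⟨hbm, h' _ _ (hdm.const_mul _) hdm hhalf hm2, by simp, by simp,
      by simpa using hmem⟩) () trivial
  simpa using this

/-- If the functions `slopeDiff P m (mf f) f`, `f ∈ 𝔉`, lie, up to constants, in a class that is
totally bounded modulo constants, their variances are uniformly small when `m` and, uniformly,
`mf f` are close to the conditional means. -/
theorem exists_variance_slopeDiff_le (hY : MemLp (fun z : Obs d₁ d₂ => z.2.2) 2 P)
    {Φ : Set (Obs d₁ d₂ → ℝ)} (hΦ : IsDonsker P Φ) {𝔉 : Set (Dir d₁ d₂)}
    (h𝔉 : ∀ f ∈ 𝔉, Measurable f ∧ MemLp (fun z : Obs d₁ d₂ => f (z.1, z.2.1)) 2 P)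
    {ε : ℝ} (hε : 0 < ε) :
    ∃ δ : ℝ, 0 < δ ∧ ∀ (m : Cov d₂ → ℝ) (mf : Dir d₁ d₂ → Cov d₂ → ℝ) (c : Dir d₁ d₂ → ℝ),
      Measurable m → (∀ f ∈ 𝔉, Measurable (mf f)) →
      eLpNorm (fun z : Obs d₁ d₂ => condMeanY P z.1 - m z.1) 2 P ≤ ENNReal.ofReal δ →
      (∀ f ∈ 𝔉, eLpNorm (fun z : Obs d₁ d₂ => condMeanDir P f z.1 - mf f z.1) 2 P ≤
        ENNReal.ofReal δ) →
      (∀ f ∈ 𝔉, (fun z => slopeDiff P m (mf f) f z - c f) ∈ Φ) →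
      ∀ f ∈ 𝔉, variance (fun z => slopeDiff P m (mf f) f z - c f) P ≤ ε := by
  have hY0 := measurable_condMeanY P
  obtain ⟨δ, hδ, h⟩ := exists_variance_le (fun φ hφ => (hΦ.1 φ hφ).2) hΦ.totallyBounded 𝔉
    (fun f z => -2 * (f (z.1, z.2.1) - condMeanDir P f z.1)) (fun f hf => by
      have h1 := (h𝔉 f hf).1
      have h2 := measurable_condMeanDir P h1
      exact ((Dir.measurable_obs h1).sub (h2.comp measurable_fst)).const_mul _) hε
  have he := hY.sub (memLp_condMeanY hY)
  obtain ⟨δ', hδ', h'⟩ := exists_eLpNorm_two_mul_le he hδ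
  refine ⟨min δ δ', lt_min hδ hδ', fun m mf c hm hmf hm2 hmf2 hmem => ?_⟩
  have hdm : Measurable fun z : Obs d₁ d₂ => condMeanY P z.1 - m z.1 :=
    (hY0.comp measurable_fst).sub (hm.comp measurable_fst)
  have hdL : MemLp (fun z : Obs d₁ d₂ => condMeanY P z.1 - m z.1) 2 P :=
    ⟨hdm.aestronglyMeasurable, hm2.trans_lt ENNReal.ofReal_lt_top⟩
  -- The product part is the error of m times the residual of f, on which no uniform bound is
  -- available; the rest is small in L¹ by Hölder's inequality.
  refine h (fun z => condMeanY P z.1 - m z.1)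
    (fun f z => ((z.2.2 - condMeanY P z.1) + (condMeanY P z.1 - m z.1)) *
      (2 * (mf f z.1 - condMeanDir P f z.1))) c hdm ?_ fun f hf => ?_
  · exact (eLpNorm_le_eLpNorm_of_exponent_le (by norm_num) hdm.aestronglyMeasurable).trans
      (hm2.trans (ENNReal.ofReal_le_ofReal (min_le_left _ _)))
  have hfm := (h𝔉 f hf).1
  have hf0 := measurable_condMeanDir P hfm
  have hmfm := hmf f hf
  have hγ : Measurable fun z : Obs d₁ d₂ => mf f z.1 - condMeanDir P f z.1 :=
    (hmfm.comp measurable_fst).sub (hf0.comp measurable_fst)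
  have hu := (h𝔉 f hf).2.sub (memLp_condMeanDir hfm (h𝔉 f hf).2)
  have hcomm : (fun z : Obs d₁ d₂ => mf f z.1 - condMeanDir P f z.1) =
      -fun z : Obs d₁ d₂ => condMeanDir P f z.1 - mf f z.1 := by ext z; simp
  have hem : Measurable fun z : Obs d₁ d₂ => z.2.2 - condMeanY P z.1 :=
    (measurable_snd.comp measurable_snd).sub (hY0.comp measurable_fst)
  refine ⟨(hem.add hdm).mul (hγ.const_mul 2), h' _ _ hdm hγ (hm2.trans (ENNReal.ofReal_le_ofReal (min_le_right _ _))) ?_,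
    hdL.integrable_mul (hu.const_mul (-2)), ?_, hmem f hf⟩
  · rw [hcomm, eLpNorm_neg]
    exact (hmf2 f hf).trans (ENNReal.ofReal_le_ofReal (min_le_right _ _))
  · simp only [mul_left_comm _ (-2 : ℝ)]
    rw [integral_const_mul, integral_mul_sub_condMeanDir hfm (h𝔉 f hf).2
      (v := fun w => condMeanY P w - m w) hdL, mul_zero]

end Regression

end ImprovementInFit

end

/-! ### The main theorem -/

open ImprovementInFit in
theorem lemma2 {d₁ d₂ : ℕ} {Ω : Type*} [MeasurableSpace Ω] (μ : Measure Ω) [IsProbabilityMeasure μ]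
    -- the i.i.d. observations, with law `P₀`
    (P₀ : Measure (Obs d₁ d₂)) [IsProbabilityMeasure P₀]
    (Z : ℕ → Ω → Obs d₁ d₂) (hZ : ∀ i, Measurable (Z i)) (hindep : iIndepFun Z μ)
    (hlaw : ∀ i, μ.map (Z i) = P₀)
    (hY : MemLp (fun z : Obs d₁ d₂ => z.2.2) 2 P₀)
    -- the collection of sub-models
    (𝔉 : Set (Dir d₁ d₂))
    (h𝔉 : ∀ f ∈ 𝔉, Measurable f ∧ MemLp (fun z : Obs d₁ d₂ => f (z.1, z.2.1)) 2 P₀)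
    (B : Set ℝ) (hBint : B.OrdConnected) (hBsymm : ∀ β ∈ B, -β ∈ B) (hBbdd : Bornology.IsBounded B)
    -- the nuisance estimators
    (mY : ℕ → Ω → Cov d₂ → ℝ) (hmY : ∀ n ω, Measurable (mY n ω))
    (mF : ℕ → Ω → Dir d₁ d₂ → Cov d₂ → ℝ) (hmF : ∀ n ω, ∀ f ∈ 𝔉, Measurable (mF n ω f))
    -- the `L²` rate for the estimator of the conditional mean of the outcome
    (hrateY : IsLittleOP μ
      (fun n ω => eLpNorm (fun z : Obs d₁ d₂ => condMeanY P₀ z.1 - mY n ω z.1) 2 P₀)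
      (fun n => (n : ℝ) ^ (-(1 / 4) : ℝ)))
    -- the rate for the product of the nuisance errors
    (hrateProd : IsLittleOP μ
      (fun n ω => ⨆ f ∈ 𝔉, ENNReal.ofReal
        |∫ z, (condMeanDir P₀ f z.1 - mF n ω f z.1) * (condMeanY P₀ z.1 - mY n ω z.1) ∂P₀|)
      (fun n => (n : ℝ) ^ (-(1 / 2) : ℝ)))
    -- uniform consistency, without a rate, of the estimators of the conditional means of `f(W, X)`
    (hconsF : IsLittleOP μ
      (fun n ω => ⨆ f ∈ 𝔉,
        eLpNorm (fun z : Obs d₁ d₂ => condMeanDir P₀ f z.1 - mF n ω f z.1) 2 P₀)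
      (fun _ => 1))
    -- the complexity constraints
    (Φ Φ' Φ'' : Set (Obs d₁ d₂ → ℝ))
    (hΦ : IsDonsker P₀ Φ) (hΦ' : IsDonsker P₀ Φ') (hΦ'' : IsGlivenkoCantelli P₀ Φ'')
    (hmem : WithProbTendingToOne μ fun n ω => ∀ f ∈ 𝔉, ∀ β ∈ B,
      (fun z => estInfluence Z mY mF n ω f z β - effInfluence P₀ f z β) ∈ Φ)
    (hmem' : WithProbTendingToOne μ fun n ω => ∀ f ∈ 𝔉,
      (fun z => deriv (estInfluence Z mY mF n ω f z) 0 - deriv (effInfluence P₀ f z) 0) ∈ Φ')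
    (hmem'' : WithProbTendingToOne μ fun n ω => ∀ f ∈ 𝔉,
      (fun z => deriv (deriv (estInfluence Z mY mF n ω f z)) 0
        - deriv (deriv (effInfluence P₀ f z)) 0) ∈ Φ'') :
    AgreeAtZero 𝔉 (oneStep Z mY mF) ∧
    UniformlyAsympLinear μ Z 𝔉 B (oneStep Z mY mF) (goodnessOfFit P₀) (effInfluence P₀) ∧
    DerivAsympLinear μ Z 𝔉 B (oneStep Z mY mF) (goodnessOfFit P₀) (effInfluence P₀) ∧
    SecondDerivConsistent μ Z 𝔉 B (oneStep Z mY mF) (goodnessOfFit P₀) (effInfluence P₀) := by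
  have hsub : ∀ n : ℕ, n ≠ 0 → (n : ℝ) ^ (-(1 / 4) : ℝ) ≤ 1 := fun n hn =>
    Real.rpow_le_one_of_one_le_of_nonpos (by exact_mod_cast Nat.one_le_iff_ne_zero.2 hn)
      (by norm_num)
  have hd : ∀ δ : ℝ, 0 < δ → WithProbTendingToOne μ fun n ω =>
      eLpNorm (fun z : Obs d₁ d₂ => condMeanY P₀ z.1 - mY n ω z.1) 2 P₀ ≤ ENNReal.ofReal δ := by
    intro δ hδ
    refine (isLittleOP_iff.1 hrateY δ hδ).mono ?_
    filter_upwards [eventually_ne_atTop 0] with n hn ω h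
    exact h.trans (ENNReal.ofReal_le_ofReal (mul_le_of_le_one_right hδ.le (hsub n hn)))
  have hg : ∀ δ : ℝ, 0 < δ → WithProbTendingToOne μ fun n ω => ∀ f ∈ 𝔉,
      eLpNorm (fun z : Obs d₁ d₂ => condMeanDir P₀ f z.1 - mF n ω f z.1) 2 P₀ ≤
        ENNReal.ofReal δ := by
    intro δ hδ
    refine (isLittleOP_iff.1 hconsF δ hδ).mono (Eventually.of_forall fun n ω h => ?_)
    simpa only [iSup_le_iff, mul_one] using h
  have hdL : ∀ n ω (δ : ℝ),
      eLpNorm (fun z : Obs d₁ d₂ => condMeanY P₀ z.1 - mY n ω z.1) 2 P₀ ≤ ENNReal.ofReal δ →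
      MemLp (fun z : Obs d₁ d₂ => condMeanY P₀ z.1 - mY n ω z.1) 2 P₀ := fun n ω δ h =>
    ⟨(((measurable_condMeanY P₀).comp measurable_fst).sub
      ((hmY n ω).comp measurable_fst)).aestronglyMeasurable, h.trans_lt ENNReal.ofReal_lt_top⟩
  have hgL : ∀ n ω (δ : ℝ), ∀ f ∈ 𝔉,
      eLpNorm (fun z : Obs d₁ d₂ => condMeanDir P₀ f z.1 - mF n ω f z.1) 2 P₀ ≤
        ENNReal.ofReal δ →
      MemLp (fun z : Obs d₁ d₂ => condMeanDir P₀ f z.1 - mF n ω f z.1) 2 P₀ := fun n ω δ f hf h =>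
    ⟨(((measurable_condMeanDir P₀ (h𝔉 f hf).1).comp measurable_fst).sub
      ((hmF n ω f hf).comp measurable_fst)).aestronglyMeasurable, h.trans_lt ENNReal.ofReal_lt_top⟩
  -- the slope of the remainder
  have hslope : ∀ ε : ℝ, 0 < ε → WithProbTendingToOne μ fun n ω => ∀ f ∈ 𝔉,
      |empMean (sample Z n ω) (slopeDiff P₀ (mY n ω) (mF n ω f) f)| ≤
        ε * (n : ℝ) ^ (-(1 / 2) : ℝ) := by
    intro ε hε
    have hmem₁ : WithProbTendingToOne μ fun n ω => ∀ f ∈ 𝔉,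
        (fun z => slopeDiff P₀ (mY n ω) (mF n ω f) f z -
          (deriv (plugIn Z mY n ω f) 0 - deriv (goodnessOfFit P₀ f) 0)) ∈ Φ' := by
      refine hmem'.mono (Eventually.of_forall fun n ω h f hf => ?_)
      rw [← deriv_estInfluence_sub_effInfluence_zero Z mY mF hY (h𝔉 f hf).2]
      exact h f hf
    refine hΦ'.withProbTendingToOne_empMean_le hZ hindep hlaw hmem₁ (fun ρ hρ => ?_)
      (fun η hη => ?_) hε
    · obtain ⟨δ, hδ, h⟩ := exists_variance_slopeDiff_le hY hΦ' h𝔉 hρ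
      refine ((hmem₁.and (hd δ hδ)).and (hg δ hδ)).mono (Eventually.of_forall ?_)
      rintro n ω ⟨⟨h1, h2⟩, h3⟩
      exact h (mY n ω) (mF n ω) _ (hmY n ω) (hmF n ω) h2 h3 h1
    -- The half offsets the factor -2 in the mean; the bounds with δ = 1 serve only for
    -- square-integrability.
    · refine (((isLittleOP_iff.1 hrateProd (η / 2) (half_pos hη)).and (hd 1 one_pos)).and
        (hg 1 one_pos)).mono (Eventually.of_forall ?_)
      rintro n ω ⟨⟨h1, h2⟩, h3⟩ f hf
      rw [integral_slopeDiff hY (hdL n ω 1 h2) (h𝔉 f hf).1 (h𝔉 f hf).2 (hgL n ω 1 f hf (h3 f hf)),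
        abs_mul]
      simp only [iSup_le_iff] at h1
      have h4 := (ENNReal.ofReal_le_ofReal_iff (by positivity)).1 (h1 f hf)
      rw [abs_neg, abs_two]
      linarith
  -- the value of the remainder at zero
  have hbase : (0 : ℝ) ∈ B → ∀ ε : ℝ, 0 < ε → WithProbTendingToOne μ fun n ω => ∀ f ∈ 𝔉,
      |empMean (sample Z n ω) (baseDiff P₀ (mY n ω))| ≤ ε * (n : ℝ) ^ (-(1 / 2) : ℝ) := by
    intro h0 ε hε
    have hmem₀ : WithProbTendingToOne μ fun n ω => ∀ f ∈ 𝔉,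
        (fun z => baseDiff P₀ (mY n ω) z - (plugIn Z mY n ω f 0 - goodnessOfFit P₀ f 0)) ∈ Φ := by
      refine hmem.mono (Eventually.of_forall fun n ω h f hf => ?_)
      rw [← estInfluence_sub_effInfluence_zero Z mY mF]
      exact h f hf 0 h0
    refine hΦ.withProbTendingToOne_empMean_le hZ hindep hlaw
      (F := fun n ω _ => baseDiff P₀ (mY n ω)) hmem₀ (fun ρ hρ => ?_) (fun η hη => ?_) hε
    · obtain ⟨δ, hδ, h⟩ := exists_variance_baseDiff_le hY hΦ hρ
      refine (hmem₀.and (hd δ hδ)).mono (Eventually.of_forall ?_)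
      rintro n ω ⟨h1, h2⟩ f hf
      exact h (mY n ω) _ (hmY n ω) h2 (h1 f hf)
    -- The mean is the squared L² error, and (√η n^{-1/4})² = η n^{-1/2}.
    · refine (isLittleOP_iff.1 hrateY (√η) (Real.sqrt_pos.2 hη)).mono
        (Eventually.of_forall fun n ω h f _ => ?_)
      rw [integral_baseDiff hY (hdL n ω _ h)]
      refine (abs_integral_sq_le (by positivity) h).trans_eq ?_
      rw [mul_pow, Real.sq_sqrt hη.le, ← Real.rpow_natCast, ← Real.rpow_mul (Nat.cast_nonneg n)]
      norm_num
  obtain ⟨M, hM0, hM⟩ := hBbdd.exists_pos_norm_le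
  refine ⟨fun n ω f₁ _ f₂ _ _ => by simp [oneStep_eq], ?_, ⟨fun n ω f hf β _ => ?_, ?_⟩,
    ⟨fun n ω f hf β _ => ?_, ?_⟩⟩
  · refine isLittleOP_iff.2 fun ε hε => ?_
    rcases B.eq_empty_or_nonempty with hB | ⟨β₀, hβ₀⟩
    · simp [hB, WithProbTendingToOne]
    -- A nonempty symmetric interval contains the segment between β₀ and -β₀, hence 0.
    have h0 : (0 : ℝ) ∈ B := by
      rcases le_total 0 β₀ with h | h
      · exact hBint.out (hBsymm _ hβ₀) hβ₀ ⟨by linarith, h⟩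
      · exact hBint.out hβ₀ (hBsymm _ hβ₀) ⟨h, by linarith⟩
    refine ((hbase h0 (ε / 2) (half_pos hε)).and (hslope (ε / (2 * M)) (by positivity))).mono ?_
    filter_upwards [eventually_ne_atTop 0] with n hn
    rintro ω ⟨h1, h2⟩
    refine iSup₂_le fun f hf => iSup₂_le fun β hβ => ENNReal.ofReal_le_ofReal ?_
    rw [remainder_eq Z mY mF hn, zero_mul, add_zero]
    refine (abs_add_le _ _).trans ?_
    have h3 := mul_le_mul (h2 f hf) (hM β hβ) (norm_nonneg β) (by positivity)
    rw [Real.norm_eq_abs, ← abs_mul] at h3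
    calc _ ≤ ε / 2 * (n : ℝ) ^ (-(1 / 2) : ℝ) + ε / (2 * M) * (n : ℝ) ^ (-(1 / 2) : ℝ) * M :=
          add_le_add (h1 f hf) h3
      _ = ε * (n : ℝ) ^ (-(1 / 2) : ℝ) := by field_simp; ring
  · obtain ⟨a, b, c, h⟩ := exists_remainder_eq Z mY mF hY (h𝔉 f hf).2 n ω
    exact ⟨(hasDerivAt_quadratic (oneStep_eq Z mY mF n ω f) β).differentiableAt,
      (hasDerivAt_quadratic h β).differentiableAt⟩
  · refine isLittleOP_iff.2 fun ε hε => (hslope ε hε).mono ?_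
    filter_upwards [eventually_ne_atTop 0] with n hn ω h
    refine iSup₂_le fun f hf => iSup₂_le fun β _ => ENNReal.ofReal_le_ofReal ?_
    rw [deriv_quadratic (remainder_eq Z mY mF hn ω f)]
    simpa using h f hf
  · obtain ⟨a, b, c, h⟩ := exists_remainder_eq Z mY mF hY (h𝔉 f hf).2 n ω
    exact ⟨differentiableAt_deriv_quadratic (oneStep_eq Z mY mF n ω f) β,
      differentiableAt_deriv_quadratic h β⟩
  · refine isLittleOP_iff.2 fun ε hε => ?_
    -- The remainder is affine for n ≠ 0, so its second derivative is zero at every ω.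
    have htriv : WithProbTendingToOne μ fun _ _ => True := by simp [WithProbTendingToOne]
    refine htriv.mono ?_
    filter_upwards [eventually_ne_atTop 0] with n hn ω _
    refine iSup₂_le fun f _ => iSup₂_le fun β _ => ENNReal.ofReal_le_ofReal ?_
    rw [deriv_quadratic (remainder_eq Z mY mF hn ω f)]
    simp [hε.le]
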